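/- Let $1\le m\le n$ be integers and let $F\subset\mathbb{R}^n$ be non-empty and bounded. Write $|U|$ for the diameter of $U$, let $G(n,m)$ be the Grassmannian of $m$-dimensional linear subspaces of $\mathbb{R}^n$, let $\gamma_{n,m}$ be its natural rotation-invariant Borel probability measure (the image of normalized Haar measure on $O(n)$ under $g\mapsto gV_0$ for a fixed $V_0\in G(n,m)$), and let $\pi_V$ be orthogonal projection onto $V\in G(n,m)$. For $\theta\in(0,1]$ and $E\subset\mathbb{R}^n$ non-empty and bounded, the lower $\theta$-intermediate dimension $\underline{\dim}_\theta E$ is the infimum of the $s\ge 0$ such that for all $\epsilon>0$ and $\delta_0>0$ there are $0<\delta\le\delta_0$ and a finite or countable cover $\{U_i\}$ of $E$ with $\delta^{1/\theta}\le|U_i|\le\delta$ for all $i$ and $\sum_i|U_i|^s\le\epsilon$. The upper $\theta$-intermediate dimension $\overline{\dim}_\theta E$ is the infimum of the $s\ge 0$ such that for all $\epsilon>0$ there is $\delta_0>0$ such that for every $0<\delta\le\delta_0$ there is such a cover. For $0\le s\le m$ and $0<r<1$ let $$\phi_{r,\theta}^{s,m}(x)=\begin{cases}1 & |x|<r,\\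 (r/|x|)^s & r\le|x|<r^\theta,\\ r^{\theta(m-s)+s}/|x|^m & r^\theta\le|x|,\end{cases}\qquad x\in\mathbb{R}^n,$$ and let the capacity be $$C_{r,\theta}^{s,m}(F)=\Big(\inf_\mu\iint\phi_{r,\theta}^{s,m}(x-y)\,d\mu(x)\,d\mu(y)\Big)^{-1},$$ where $\mu$ runs over the Borel probability measures supported on the closure $\overline F$. Then: 1. For every $\theta\in(0,1]$ there is exactly one $s\in[0,m]$ with $\liminf_{r\to0}\frac{\log C_{r,\theta}^{s,m}(F)}{-\log r}=s$, and exactly one $s\in[0,m]$ with $\limsup_{r\to0}\frac{\log C_{r,\theta}^{s,m}(F)}{-\log r}=s$. These are the lower and upper $\theta$-intermediate dimension profiles of $F$, denoted $\underline{\dim}_\theta^m F$ and $\overline{\dim}_\theta^m F$. 2. For all $V\in G(n,m)$ and all $\theta\in(0,1]$, $$\underline{\dim}_\theta\,\pi_VF\le\underline{\dim}_\theta^mF\quad\text{and}\quad\overline{\dim}_\theta\,\pi_VF\le\overline{\dim}_\theta^mF.$$ 3. For $\gamma_{n,m}$-almost all $V\in G(n,m)$, simultaneously for all $\theta\in(0,1]$,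 $$\underline{\dim}_\theta\,\pi_VF=\underline{\dim}_\theta^mF\quad\text{and}\quad\overline{\dim}_\theta\,\pi_VF=\overline{\dim}_\theta^mF.$$ -/

import Mathlib

open MeasureTheory Filter Topology Set
open scoped ENNReal

/-! ### Intermediate dimensions -/

/-- `ThetaCover F θ δ s ε`: there is a finite or countable family of subsets `U` of the ambient
space that covers `F`, all with `δ ^ (1 / θ) ≤ |U| ≤ δ`, and with `∑ |U| ^ s ≤ ε`, where `|U|` is
the diameter (sums and diameters are taken in `[0, ∞]`). Meant for `0 < θ ≤ 1`. -/
def ThetaCover {X : Type*} [PseudoMetricSpace X] (F : Set X) (θ δ s ε : ℝ) : Prop :=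
  ∃ 𝒰 : Set (Set X), 𝒰.Countable ∧ F ⊆ ⋃₀ 𝒰 ∧
    (∀ U ∈ 𝒰, ENNReal.ofReal (δ ^ (1 / θ)) ≤ Metric.ediam U ∧
      Metric.ediam U ≤ ENNReal.ofReal δ) ∧
    ∑' U : 𝒰, Metric.ediam (U : Set X) ^ s ≤ ENNReal.ofReal ε

/-- The lower `θ`-intermediate dimension of `F`, for `0 < θ ≤ 1`. -/
noncomputable def lowerInterDim {X : Type*} [PseudoMetricSpace X] (θ : ℝ) (F : Set X) : ℝ :=
  sInf {s : ℝ | 0 ≤ s ∧ ∀ ε > 0, ∀ δ₀ > 0, ∃ δ, 0 < δ ∧ δ ≤ δ₀ ∧ ThetaCover F θ δ s ε}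

/-- The upper `θ`-intermediate dimension of `F`, for `0 < θ ≤ 1`. -/
noncomputable def upperInterDim {X : Type*} [PseudoMetricSpace X] (θ : ℝ) (F : Set X) : ℝ :=
  sInf {s : ℝ | 0 ≤ s ∧ ∀ ε > 0, ∃ δ₀ > 0, ∀ δ, 0 < δ → δ ≤ δ₀ → ThetaCover F θ δ s ε}

/-! ### Kernels, capacities and dimension profiles -/

/-- The kernel `φ_{r,θ}^{s,m}(x)` on `ℝⁿ`. -/
noncomputable def interKernel {n : ℕ} (r θ s m : ℝ) (x : EuclideanSpace ℝ (Fin n)) : ℝ :=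
  if ‖x‖ < r then 1
  else if ‖x‖ < r ^ θ then (r / ‖x‖) ^ s
  else r ^ (θ * (m - s) + s) / ‖x‖ ^ m

/-- The energy of a measure with respect to the kernel `φ_{r,θ}^{s,m}`. -/
noncomputable def interEnergy {n : ℕ} (r θ s m : ℝ)
    (μ : Measure (EuclideanSpace ℝ (Fin n))) : ℝ :=
  ∫ y, ∫ x, interKernel r θ s m (x - y) ∂μ ∂μ

/-- The capacity `C_{r,θ}^{s,m}(F)`: the reciprocal of the infimum of the energies of the Borel
probability measures supported on the closure of `F`. -/
noncomputable def interCapacity {n : ℕ} (r θ s m : ℝ) (F : Set (EuclideanSpace ℝ (Fin n))) : ℝ :=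
  (sInf {e : ℝ | ∃ μ : Measure (EuclideanSpace ℝ (Fin n)), IsProbabilityMeasure μ ∧
    μ (closure F)ᶜ = 0 ∧ e = interEnergy r θ s m μ})⁻¹

/-- `s ∈ [0, m]` satisfies `liminf_{r → 0} log C_{r,θ}^{s,m}(F) / (-log r) = s`. -/
def IsLowerProfile {n : ℕ} (θ m : ℝ) (F : Set (EuclideanSpace ℝ (Fin n))) (s : ℝ) : Prop :=
  s ∈ Icc 0 m ∧
    liminf (fun r : ℝ => Real.log (interCapacity r θ s m F) / (-Real.log r)) (𝓝[>] 0) = s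

/-- `s ∈ [0, m]` satisfies `limsup_{r → 0} log C_{r,θ}^{s,m}(F) / (-log r) = s`. -/
def IsUpperProfile {n : ℕ} (θ m : ℝ) (F : Set (EuclideanSpace ℝ (Fin n))) (s : ℝ) : Prop :=
  s ∈ Icc 0 m ∧
    limsup (fun r : ℝ => Real.log (interCapacity r θ s m F) / (-Real.log r)) (𝓝[>] 0) = s

/-- The lower `θ`-intermediate dimension profile: the unique `s` with `IsLowerProfile θ m F s`
(the infimum picks out that `s`). -/
noncomputable def lowerProfile {n : ℕ} (θ m : ℝ) (F : Set (EuclideanSpace ℝ (Fin n))) : ℝ :=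
  sInf {s : ℝ | IsLowerProfile θ m F s}

/-- The upper `θ`-intermediate dimension profile: the unique `s` with `IsUpperProfile θ m F s`
(the infimum picks out that `s`). -/
noncomputable def upperProfile {n : ℕ} (θ m : ℝ) (F : Set (EuclideanSpace ℝ (Fin n))) : ℝ :=
  sInf {s : ℝ | IsUpperProfile θ m F s}

/-! ### The Grassmannian and its invariant probability measure -/

/-- The Grassmannian `G(n, m)` of `m`-dimensional linear subspaces of `ℝⁿ`. -/
def Grassmann (n m : ℕ) : Type :=
  {V : Submodule ℝ (EuclideanSpace ℝ (Fin n)) // Module.finrank ℝ V = m}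

/-- Orthogonal projection onto `V`, as a map `ℝⁿ → ℝⁿ` with range `V`. -/
noncomputable def Grassmann.proj {n m : ℕ} (V : Grassmann n m) :
    EuclideanSpace ℝ (Fin n) →L[ℝ] EuclideanSpace ℝ (Fin n) :=
  V.1.starProjection

/-- The usual topology of `G(n, m)`, given by the metric `‖π_V - π_W‖`. -/
noncomputable instance Grassmann.instTopologicalSpace (n m : ℕ) : TopologicalSpace (Grassmann n m) :=
  TopologicalSpace.induced Grassmann.proj inferInstance

/-- The Borel `σ`-algebra of `G(n, m)`. -/
noncomputable instance Grassmann.instMeasurableSpace (n m : ℕ) : MeasurableSpace (Grassmann n m) :=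
  borel _

instance Grassmann.instBorelSpace (n m : ℕ) : BorelSpace (Grassmann n m) := ⟨rfl⟩

/-- The orthogonal group `O(n)` of `ℝⁿ`, with the topology of the operator norm and its Borel
`σ`-algebra. -/
abbrev OrthGroup (n : ℕ) : Type :=
  unitary (EuclideanSpace ℝ (Fin n) →L[ℝ] EuclideanSpace ℝ (Fin n))

instance OrthGroup.instContinuousStar (n : ℕ) :
    ContinuousStar (EuclideanSpace ℝ (Fin n) →L[ℝ] EuclideanSpace ℝ (Fin n)) :=
  ⟨ContinuousLinearMap.adjoint.continuous⟩

instance OrthGroup.instCompactSpace (n : ℕ) : CompactSpace (OrthGroup n) := by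
  refine isCompact_iff_compactSpace.mp
    (Metric.isCompact_of_isClosed_isBounded isClosed_unitary ?_)
  refine (Metric.isBounded_closedBall (x := 0) (r := 1)).subset fun u hu => ?_
  rw [mem_closedBall_zero_iff]
  refine ContinuousLinearMap.opNorm_le_bound _ zero_le_one fun x => ?_
  rw [one_mul]
  exact (Unitary.norm_map ⟨u, hu⟩ x).le

/-- The normalized Haar measure of `O(n)`. -/
noncomputable def OrthGroup.haar (n : ℕ) : Measure (OrthGroup n) :=
  Measure.haarMeasure ⊤

instance OrthGroup.instIsProbabilityMeasure (n : ℕ) : IsProbabilityMeasure (OrthGroup.haar n) :=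
  ⟨Measure.haarMeasure_self (K₀ := (⊤ : TopologicalSpace.PositiveCompacts (OrthGroup n)))⟩

/-- The action of `O(n)` on `G(n, m)`: the image of `V` under `g`. -/
noncomputable def Grassmann.image {n m : ℕ} (V : Grassmann n m) (g : OrthGroup n) :
    Grassmann n m :=
  ⟨V.1.map (Unitary.linearIsometryEquiv g).toLinearEquiv.toLinearMap,
    ((Unitary.linearIsometryEquiv g).toLinearEquiv.finrank_map_eq V.1).trans V.2⟩

theorem Grassmann.continuous_image {n m : ℕ} (V : Grassmann n m) : Continuous V.image := by
  refine continuous_induced_rng.mpr ?_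
  have h : Grassmann.proj ∘ V.image = fun g : OrthGroup n =>
      (g : EuclideanSpace ℝ (Fin n) →L[ℝ] EuclideanSpace ℝ (Fin n)) * V.proj *
        ((star g : OrthGroup n) : EuclideanSpace ℝ (Fin n) →L[ℝ] EuclideanSpace ℝ (Fin n)) := by
    funext g
    ext1 x
    exact Submodule.starProjection_map_apply (Unitary.linearIsometryEquiv g) V.1 x
  rw [h]
  fun_prop

/-- The subspace of `ℝⁿ` spanned by the first `m` coordinate vectors. -/
noncomputable def Grassmann.base {n m : ℕ} (h : m ≤ n) : Grassmann n m :=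
  ⟨Submodule.span ℝ (range fun i : Fin m => EuclideanSpace.basisFun (Fin n) ℝ (Fin.castLE h i)), by
    have hl := (EuclideanSpace.basisFun (Fin n) ℝ).orthonormal.linearIndependent.comp
      (Fin.castLE h) (Fin.castLE_injective h)
    exact (finrank_span_eq_card hl).trans (Fintype.card_fin m)⟩

/-- The natural invariant probability measure `γ_{n,m}` on `G(n, m)`: the law of `g V₀`, where
`g` is distributed according to the normalized Haar measure of `O(n)` and `V₀` is a fixed
`m`-dimensional subspace (its choice is immaterial, by invariance). -/
noncomputable def grassmannMeasure {n m : ℕ} (h : m ≤ n) : Measure (Grassmann n m) :=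
  (OrthGroup.haar n).map (Grassmann.base h).image

instance grassmannMeasure.instIsProbabilityMeasure {n m : ℕ} (h : m ≤ n) :
    IsProbabilityMeasure (grassmannMeasure h) :=
  Measure.isProbabilityMeasure_map (Grassmann.continuous_image _).measurable.aemeasurable

/-! Well-definedness of the profiles. Put `g s` for the lower (or upper) limit of `capacityRate θ s
m F`. Raising `s` to `s'` raises the capacity, but by a factor of at most `r ^ (-((1 - θ) * (s' -
s)))`. So `g` is non-decreasing with slopes at most `1 - θ < 1`, and `0 ≤ g 0`, `g m ≤ m`: it has
exactly one fixed point in `[0, m]` (`existsUnique_fixedPoint_of_slope`).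

Upper bound, for every `V`. Let `I` be the minimal energy, the reciprocal of the capacity. Moving a
little mass of a near-minimizer `μ` to a point `x` cannot bring the energy below `I`, so the
potential of `μ` is at least `I / 4` at every `x` in `closure F` (`exists_potential_ge`). Projection
shrinks distances and the kernel is radially decreasing, hence the potential after projection is no
smaller. It splits over about `log (1 / r)` dyadic scales `R`, and at one of them the `R`-ball
around the projected point has large projected mass. Points that share a scale `R` are covered by
balls of diameter `τ = min R (r ^ θ)`. A bounded-overlap count inside the `m`-dimensional space `V`
bounds their number, and the kernel is such that the cost is the same at all scales
(`radialKernel_mul_cost`). The total is the capacity times `r ^ s`, up to squared logarithms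
(`Grassmann.exists_cover_le_capacity`). Sums with an exponent `t > s` then tend to zero.

Lower bound, for almost every `V`. The probability that `‖V.proj x‖ ≤ R` is at most a constant times
`(R / ‖x‖) ^ m`, so the average over `V` of `(r / ‖V.proj x‖) ^ s`, cut off near `r ^ θ`, is at most
a logarithm times the kernel at `x` (`lintegral_scaleKernel_le`). Fubini, Markov's inequality and
Borel–Cantelli along `r = 2 ^ (-j)` give, for almost all `V`, measures on `closure F` whose
projected energies are nearly `I` (`ae_hasRegularProjection`). By a mass distribution argument such
measures make every cover expensive (`Grassmann.half_le_cost`).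

One null set serves all `θ`: regularity is required only at rational parameters, and the capacity
changes by small powers of `r` when `θ` and `s` move slightly, which transfers the conclusion to
real parameters. -/

/-! ### The radial profile of the kernel -/

/-- The radial profile of `interKernel`, in product form. -/
noncomputable def radialKernel (r θ s m t : ℝ) : ℝ :=
  (r / max t r) ^ s * min 1 (r ^ θ / max t r) ^ (m - s)

section RadialKernel

variable {r θ s m t : ℝ}

theorem radialKernel_of_le (h : r ≤ t) :
    radialKernel r θ s m t = (r / t) ^ s * min 1 (r ^ θ / t) ^ (m - s) := by
  rw [radialKernel, max_eq_left h]

theorem radialKernel_of_ge (h : t ≤ r) (hr : 0 < r) (hr1 : r ≤ 1) (hθ : θ ≤ 1) :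
    radialKernel r θ s m t = 1 := by
  have h1 : 1 ≤ r ^ θ / r := by
    rw [one_le_div hr]
    simpa using Real.rpow_le_rpow_of_exponent_ge hr hr1 hθ
  rw [radialKernel, max_eq_right h, div_self hr.ne', min_eq_left h1, Real.one_rpow, Real.one_rpow,
    one_mul]

theorem interKernel_eq_radialKernel {n : ℕ} (hr : 0 < r) (hr1 : r ≤ 1) (hθ : θ ≤ 1)
    (x : EuclideanSpace ℝ (Fin n)) : interKernel r θ s m x = radialKernel r θ s m ‖x‖ := by
  unfold interKernel
  split_ifs with h1 h2
  · rw [radialKernel_of_ge h1.le hr hr1 hθ]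
  · push Not at h1
    have hx : 0 < ‖x‖ := hr.trans_le h1
    rw [radialKernel_of_le h1, min_eq_left ((one_le_div hx).2 h2.le), Real.one_rpow, mul_one]
  · push Not at h1 h2
    have hx : 0 < ‖x‖ := hr.trans_le h1
    have hrθ : 0 < r ^ θ := Real.rpow_pos_of_pos hr θ
    rw [radialKernel_of_le h1, min_eq_right ((div_le_one hx).2 h2),
      Real.div_rpow hr.le hx.le, Real.div_rpow hrθ.le hx.le, ← Real.rpow_mul hr.le,
      div_mul_div_comm, ← Real.rpow_add hr, ← Real.rpow_add hx]
    congr 2 <;> ring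

theorem radialKernel_pos (hr : 0 < r) : 0 < radialKernel r θ s m t := by
  have hT : 0 < max t r := lt_max_of_lt_right hr
  exact mul_pos (Real.rpow_pos_of_pos (div_pos hr hT) _)
    (Real.rpow_pos_of_pos (lt_min one_pos (div_pos (Real.rpow_pos_of_pos hr θ) hT)) _)

theorem radialKernel_le_one (hr : 0 < r) (hs : 0 ≤ s) (hsm : s ≤ m) :
    radialKernel r θ s m t ≤ 1 := by
  have hT : 0 < max t r := lt_max_of_lt_right hr
  refine mul_le_one₀ (Real.rpow_le_one (div_pos hr hT).le ((div_le_one hT).2 (le_max_right _ _)) hs)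
    (Real.rpow_nonneg ?_ _) (Real.rpow_le_one ?_ (min_le_left _ _) (sub_nonneg.2 hsm)) <;>
  exact (lt_min one_pos (div_pos (Real.rpow_pos_of_pos hr θ) hT)).le

theorem continuous_radialKernel (hr : 0 < r) (hs : 0 ≤ s) (hsm : s ≤ m) :
    Continuous (radialKernel r θ s m) := by
  have hT : ∀ t : ℝ, max t r ≠ 0 := fun t => (lt_max_of_lt_right hr).ne'
  have h1 : Continuous fun t : ℝ => max t r := by fun_prop
  exact ((continuous_const.div h1 hT).rpow_const fun _ => Or.inr hs).mul
    ((continuous_const.min (continuous_const.div h1 hT)).rpow_const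
      fun _ => Or.inr (sub_nonneg.2 hsm))

/-- Comparison of two values of the radial kernel through comparison of the factors. -/
theorem radialKernel_le_mul {r' t' c : ℝ} (hr : 0 < r) (hr' : 0 < r') (hs : 0 ≤ s) (hsm : s ≤ m)
    (hc : 0 ≤ c) (h1 : r / max t r ≤ c * (r' / max t' r'))
    (h2 : min 1 (r ^ θ / max t r) ≤ c * min 1 (r' ^ θ / max t' r')) :
    radialKernel r θ s m t ≤ c ^ m * radialKernel r' θ s m t' := by
  have hT : 0 < max t r := lt_max_of_lt_right hr
  have hT' : 0 < max t' r' := lt_max_of_lt_right hr'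
  have hp : 0 ≤ min 1 (r ^ θ / max t r) :=
    (lt_min one_pos (div_pos (Real.rpow_pos_of_pos hr θ) hT)).le
  have hp' : 0 ≤ min 1 (r' ^ θ / max t' r') :=
    (lt_min one_pos (div_pos (Real.rpow_pos_of_pos hr' θ) hT')).le
  have e : c ^ m = c ^ s * c ^ (m - s) := by
    rw [← Real.rpow_add_of_nonneg hc hs (sub_nonneg.2 hsm)]; congr 1; ring
  calc radialKernel r θ s m t
      ≤ (c * (r' / max t' r')) ^ s * (c * min 1 (r' ^ θ / max t' r')) ^ (m - s) :=
        mul_le_mul (Real.rpow_le_rpow (div_pos hr hT).le h1 hs)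
          (Real.rpow_le_rpow hp h2 (sub_nonneg.2 hsm)) (Real.rpow_nonneg hp _)
          (Real.rpow_nonneg (mul_nonneg hc (div_pos hr' hT').le) _)
    _ = c ^ m * radialKernel r' θ s m t' := by
        rw [Real.mul_rpow hc (div_pos hr' hT').le, Real.mul_rpow hc hp', e, radialKernel]
        ring

/-- Orthogonal projections shrink distances, so this monotonicity bounds potentials in the whole
space by potentials of projected points. -/
theorem radialKernel_antitone (hr : 0 < r) (hs : 0 ≤ s) (hsm : s ≤ m) :
    Antitone (radialKernel r θ s m) := by
  intro t t' h
  have hT : 0 < max t r := lt_max_of_lt_right hr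
  have hTT : max t r ≤ max t' r := max_le_max_right _ h
  have := radialKernel_le_mul (θ := θ) (t := t') (t' := t) (c := 1) hr hr hs hsm zero_le_one
    (by rw [one_mul]; gcongr) (by rw [one_mul]; gcongr)
  simpa using this

theorem radialKernel_le_double (hr : 0 < r) (hs : 0 ≤ s) (hsm : s ≤ m) :
    radialKernel r θ s m t ≤ 2 ^ m * radialKernel r θ s m (2 * t) := by
  have hT : 0 < max t r := lt_max_of_lt_right hr
  have hT' : 0 < max (2 * t) r := lt_max_of_lt_right hr
  have hTT : max (2 * t) r ≤ 2 * max t r := by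
    refine max_le (by gcongr; exact le_max_left _ _) ?_
    linarith [le_max_right t r]
  have key : ∀ a : ℝ, 0 ≤ a → a / max t r ≤ 2 * (a / max (2 * t) r) := by
    intro a ha
    rw [div_le_iff₀ hT, mul_div_assoc', div_mul_eq_mul_div, le_div_iff₀ hT']
    nlinarith
  refine radialKernel_le_mul hr hr hs hsm zero_le_two (key _ hr.le) ?_
  rw [mul_min_of_nonneg _ _ zero_le_two]
  exact min_le_min (by norm_num) (key _ (Real.rpow_nonneg hr.le _))

/-- Below `r'` the right side is 1; above `r'` both maxima equal `t` and each factor increases with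
the radius. This allows the passage from arbitrary radii to dyadic ones. -/
theorem radialKernel_mono_radius {r' : ℝ} (hr : 0 < r) (hrr : r ≤ r') (hr1 : r' ≤ 1)
    (hθ0 : 0 ≤ θ) (hθ : θ ≤ 1) (hs : 0 ≤ s) (hsm : s ≤ m) :
    radialKernel r θ s m t ≤ radialKernel r' θ s m t := by
  have hr' := hr.trans_le hrr
  rcases le_total t r' with h | h
  · rw [radialKernel_of_ge h hr' hr1 hθ]
    exact radialKernel_le_one hr hs hsm
  · have ht : 0 < t := hr'.trans_le h
    have := radialKernel_le_mul (θ := θ) (t := t) (t' := t) (c := 1) hr hr' hs hsm zero_le_one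
      (by rw [one_mul, max_eq_left h, max_eq_left (hrr.trans h)]; gcongr)
      (by rw [one_mul, max_eq_left h, max_eq_left (hrr.trans h)]; gcongr)
    simpa using this

/-- The kernel is `a ^ s * b ^ (m - s)` with `a ≤ b`, and a larger exponent moves weight from `b` to
`a`. -/
theorem radialKernel_antitone_exponent {s' : ℝ} (hr : 0 < r) (hss : s ≤ s') (hr1 : r ≤ 1)
    (hθ : θ ≤ 1) : radialKernel r θ s' m t ≤ radialKernel r θ s m t := by
  have hT : 0 < max t r := lt_max_of_lt_right hr
  set a := r / max t r with ha
  set b := min 1 (r ^ θ / max t r) with hb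
  have ha0 : 0 < a := div_pos hr hT
  have hb0 : 0 < b := lt_min one_pos (div_pos (Real.rpow_pos_of_pos hr θ) hT)
  have hrθ : r ≤ r ^ θ := by simpa using Real.rpow_le_rpow_of_exponent_ge hr hr1 hθ
  have hab : a ≤ b := le_min ((div_le_one hT).2 (le_max_right _ _)) (by rw [ha]; gcongr)
  have e1 : a ^ s' = a ^ s * a ^ (s' - s) := by rw [← Real.rpow_add ha0]; congr 1; ring
  have e2 : b ^ (m - s) = b ^ (s' - s) * b ^ (m - s') := by
    rw [← Real.rpow_add hb0]; congr 1; ring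
  change a ^ s' * b ^ (m - s') ≤ a ^ s * b ^ (m - s)
  rw [e1, e2, mul_assoc]
  have : a ^ (s' - s) ≤ b ^ (s' - s) := Real.rpow_le_rpow ha0.le hab (sub_nonneg.2 hss)
  gcongr

/-- The two bases differ by a factor of at most `r ^ (-(1 - θ))`. The resulting slope `1 - θ` of the
capacity rate is what makes the profiles unique. -/
theorem radialKernel_le_mul_exponent {s' : ℝ} (hr : 0 < r) (hss : s ≤ s') :
    radialKernel r θ s m t ≤ r ^ (-((1 - θ) * (s' - s))) * radialKernel r θ s' m t := by
  have hT : 0 < max t r := lt_max_of_lt_right hr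
  set a := r / max t r with ha
  set b := min 1 (r ^ θ / max t r) with hb
  have ha0 : 0 < a := div_pos hr hT
  have hb0 : 0 < b := lt_min one_pos (div_pos (Real.rpow_pos_of_pos hr θ) hT)
  have hba : b ≤ r ^ (-(1 - θ)) * a := by
    refine (min_le_right _ _).trans_eq ?_
    rw [ha, mul_div_assoc']
    congr 1
    rw [← Real.rpow_add_one hr.ne']; congr 1; ring
  have e1 : a ^ s' = a ^ s * a ^ (s' - s) := by rw [← Real.rpow_add ha0]; congr 1; ring
  have e2 : b ^ (m - s) = b ^ (s' - s) * b ^ (m - s') := by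
    rw [← Real.rpow_add hb0]; congr 1; ring
  have h3 : b ^ (s' - s) ≤ r ^ (-((1 - θ) * (s' - s))) * a ^ (s' - s) := by
    refine (Real.rpow_le_rpow hb0.le hba (sub_nonneg.2 hss)).trans_eq ?_
    rw [Real.mul_rpow (Real.rpow_nonneg hr.le _) ha0.le, ← Real.rpow_mul hr.le]
    congr 2; ring
  change a ^ s * b ^ (m - s) ≤ r ^ (-((1 - θ) * (s' - s))) * (a ^ s' * b ^ (m - s'))
  calc a ^ s * b ^ (m - s) = a ^ s * (b ^ (s' - s) * b ^ (m - s')) := by rw [e2]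
    _ ≤ a ^ s * (r ^ (-((1 - θ) * (s' - s))) * a ^ (s' - s) * b ^ (m - s')) := by gcongr
    _ = _ := by rw [e1]; ring

/-- Only the second factor depends on `θ`, and its base grows by at most `r ^ (-(θ - θ'))`. The loss
tends to `1` in exponent as `θ'` approaches `θ`, which permits rational approximation. -/
theorem radialKernel_le_mul_theta {θ' : ℝ} (hr : 0 < r) (hθ : θ' ≤ θ) (hr1 : r ≤ 1)
    (hsm : s ≤ m) :
    radialKernel r θ' s m t ≤ r ^ (-((θ - θ') * (m - s))) * radialKernel r θ s m t := by
  have hT : 0 < max t r := lt_max_of_lt_right hr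
  set b := min 1 (r ^ θ / max t r) with hb
  have hb0 : 0 < b := lt_min one_pos (div_pos (Real.rpow_pos_of_pos hr θ) hT)
  have hb' : min 1 (r ^ θ' / max t r) ≤ r ^ (-(θ - θ')) * b := by
    rw [hb, mul_min_of_nonneg _ _ (Real.rpow_nonneg hr.le _)]
    refine min_le_min ?_ ?_
    · rw [mul_one]
      exact Real.one_le_rpow_of_pos_of_le_one_of_nonpos hr hr1 (by linarith)
    · rw [mul_div_assoc', ← Real.rpow_add hr]
      simp
  have h3 : min 1 (r ^ θ' / max t r) ^ (m - s) ≤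
      r ^ (-((θ - θ') * (m - s))) * b ^ (m - s) := by
    refine (Real.rpow_le_rpow ?_ hb' (sub_nonneg.2 hsm)).trans_eq ?_
    · exact (lt_min one_pos (div_pos (Real.rpow_pos_of_pos hr θ') hT)).le
    · rw [Real.mul_rpow (Real.rpow_nonneg hr.le _) hb0.le, ← Real.rpow_mul hr.le]
      congr 2; ring
  change (r / max t r) ^ s * _ ≤ r ^ (-((θ - θ') * (m - s))) * ((r / max t r) ^ s * b ^ (m - s))
  rw [mul_left_comm]
  gcongr

theorem le_radialKernel {D : ℝ} (hr : 0 < r) (hr1 : r ≤ 1) (hθ0 : 0 ≤ θ) (hs : 0 ≤ s)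
    (hsm : s ≤ m) (hD : 1 ≤ D) (ht : t ≤ D) :
    r ^ (s + θ * (m - s)) / D ^ m ≤ radialKernel r θ s m t := by
  refine le_trans ?_ (radialKernel_antitone hr hs hsm ht)
  have hD0 : 0 < D := one_pos.trans_le hD
  have hrθ : r ^ θ ≤ 1 := Real.rpow_le_one hr.le hr1 hθ0
  have e : D ^ m = D ^ s * D ^ (m - s) := by rw [← Real.rpow_add hD0]; congr 1; ring
  rw [radialKernel_of_le (hr1.trans hD), min_eq_right ((div_le_one hD0).2 (hrθ.trans hD)),
    Real.div_rpow hr.le hD0.le, Real.div_rpow (Real.rpow_nonneg hr.le _) hD0.le,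
    ← Real.rpow_mul hr.le, div_mul_div_comm, ← Real.rpow_add hr, e]

/-- The balance between the kernel at a scale `R` and the cost of a cover at that scale. -/
theorem radialKernel_mul_cost {R : ℝ} (hr : 0 < r) (hR : r ≤ R) :
    radialKernel r θ s m R * ((R / min R (r ^ θ)) ^ m * min R (r ^ θ) ^ s) = r ^ s := by
  have hR0 : 0 < R := hr.trans_le hR
  set τ := min R (r ^ θ) with hτ
  have hτ0 : 0 < τ := lt_min hR0 (Real.rpow_pos_of_pos hr θ)
  have e : min 1 (r ^ θ / R) = τ / R := by
    rw [hτ, ← min_div_div_right hR0.le, div_self hR0.ne']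
  rw [radialKernel_of_le hR, e, Real.div_rpow hr.le hR0.le, Real.div_rpow hτ0.le hR0.le,
    Real.div_rpow hR0.le hτ0.le, Real.rpow_sub hτ0, Real.rpow_sub hR0]
  have := (Real.rpow_pos_of_pos hR0 s).ne'
  have := (Real.rpow_pos_of_pos hR0 m).ne'
  have := (Real.rpow_pos_of_pos hτ0 s).ne'
  have := (Real.rpow_pos_of_pos hτ0 m).ne'
  field_simp

end RadialKernel

/-! ### Energies of measures for bounded kernels -/

section Energy

variable {E : Type*} [AddCommGroup E] [MeasurableSpace E]

/-- The energy of `μ` with respect to a kernel `k`. -/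
noncomputable def kernelEnergy (k : E → ℝ) (μ : Measure E) : ℝ :=
  ∫ y, ∫ x, k (x - y) ∂μ ∂μ

/-- The energies of the probability measures carried by `S`. -/
def energySet (k : E → ℝ) (S : Set E) : Set ℝ :=
  {e : ℝ | ∃ μ : Measure E, IsProbabilityMeasure μ ∧ μ Sᶜ = 0 ∧ e = kernelEnergy k μ}

variable {k k' : E → ℝ} {μ ν : Measure E}

theorem kernelEnergy_nonneg (h0 : ∀ x, 0 ≤ k x) : 0 ≤ kernelEnergy k μ :=
  integral_nonneg fun _ => integral_nonneg fun _ => h0 _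

theorem bddBelow_energySet (h0 : ∀ x, 0 ≤ k x) (S : Set E) : BddBelow (energySet k S) :=
  ⟨0, by rintro _ ⟨μ, -, -, rfl⟩; exact kernelEnergy_nonneg h0⟩

theorem kernelEnergy_dirac [MeasurableSingletonClass E] (x : E) :
    kernelEnergy k (Measure.dirac x) = k 0 := by
  simp [kernelEnergy]

theorem energySet_nonempty [MeasurableSingletonClass E] {S : Set E} (hS : S.Nonempty) :
    k 0 ∈ energySet k S := by
  obtain ⟨x, hx⟩ := hS
  refine ⟨Measure.dirac x, inferInstance, ?_, (kernelEnergy_dirac x).symm⟩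
  rw [Measure.dirac_apply]; simp [hx]

theorem sInf_energySet_le_one [MeasurableSingletonClass E] {S : Set E} (hS : S.Nonempty)
    (h0 : ∀ x, 0 ≤ k x) (h1 : ∀ x, k x ≤ 1) : sInf (energySet k S) ≤ 1 :=
  (csInf_le (bddBelow_energySet h0 S) (energySet_nonempty hS)).trans (h1 0)

theorem exists_kernelEnergy_lt [MeasurableSingletonClass E] {S : Set E} (hS : S.Nonempty) {a : ℝ}
    (ha : sInf (energySet k S) < a) :
    ∃ μ : Measure E, IsProbabilityMeasure μ ∧ μ Sᶜ = 0 ∧ kernelEnergy k μ < a := by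
  obtain ⟨_, ⟨μ, h1, h2, rfl⟩, h⟩ := exists_lt_of_csInf_lt ⟨_, energySet_nonempty hS⟩ ha
  exact ⟨μ, h1, h2, h⟩

variable [MeasurableSub₂ E]

theorem integrable_kernel [IsFiniteMeasure μ] (hk : Measurable k) (h0 : ∀ x, 0 ≤ k x)
    (h1 : ∀ x, k x ≤ 1) (y : E) : Integrable (fun x => k (x - y)) μ :=
  Integrable.of_bound (C := 1) (hk.comp (measurable_id.sub_const y)).aestronglyMeasurable
    (Eventually.of_forall fun x => by
      rw [Real.norm_eq_abs, abs_of_nonneg (h0 _)]; exact h1 _)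

theorem integrable_kernel_prod [IsFiniteMeasure μ] [IsFiniteMeasure ν] (hk : Measurable k)
    (h0 : ∀ x, 0 ≤ k x) (h1 : ∀ x, k x ≤ 1) :
    Integrable (fun p : E × E => k (p.2 - p.1)) (μ.prod ν) :=
  Integrable.of_bound (C := 1)
    (hk.comp (measurable_snd.sub measurable_fst)).aestronglyMeasurable
    (Eventually.of_forall fun x => by
      rw [Real.norm_eq_abs, abs_of_nonneg (h0 _)]; exact h1 _)

theorem integrable_potential [IsFiniteMeasure μ] [IsFiniteMeasure ν] (hk : Measurable k)
    (h0 : ∀ x, 0 ≤ k x) (h1 : ∀ x, k x ≤ 1) : Integrable (fun y => ∫ x, k (x - y) ∂ν) μ :=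
  (integrable_kernel_prod (μ := μ) (ν := ν) hk h0 h1).integral_prod_left

theorem kernelEnergy_le_mul [IsFiniteMeasure μ] {c : ℝ} (hk : Measurable k) (h0 : ∀ x, 0 ≤ k x)
    (h1 : ∀ x, k x ≤ 1) (hk' : Measurable k') (h0' : ∀ x, 0 ≤ k' x) (h1' : ∀ x, k' x ≤ 1)
    (h : ∀ x, k x ≤ c * k' x) : kernelEnergy k μ ≤ c * kernelEnergy k' μ := by
  unfold kernelEnergy
  rw [← integral_const_mul]
  refine integral_mono (integrable_potential hk h0 h1)
    ((integrable_potential hk' h0' h1').const_mul c) fun y => ?_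
  simp only
  rw [← integral_const_mul]
  exact integral_mono (integrable_kernel hk h0 h1 y)
    ((integrable_kernel hk' h0' h1' y).const_mul c) fun x => h _

theorem sInf_energySet_le_mul [MeasurableSingletonClass E] {S : Set E} (hS : S.Nonempty) {c : ℝ}
    (hk : Measurable k) (h0 : ∀ x, 0 ≤ k x)
    (h1 : ∀ x, k x ≤ 1) (hk' : Measurable k') (h0' : ∀ x, 0 ≤ k' x) (h1' : ∀ x, k' x ≤ 1)
    (hc : 0 < c) (h : ∀ x, k x ≤ c * k' x) :
    sInf (energySet k S) ≤ c * sInf (energySet k' S) := by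
  rw [← div_le_iff₀' hc]
  refine le_csInf ⟨_, energySet_nonempty hS⟩ ?_
  rintro _ ⟨μ, hμ, hμS, rfl⟩
  rw [div_le_iff₀' hc]
  exact (csInf_le (bddBelow_energySet h0 S) ⟨μ, hμ, hμS, rfl⟩).trans
    (kernelEnergy_le_mul hk h0 h1 hk' h0' h1' h)

theorem le_sInf_energySet [MeasurableSingletonClass E] {S : Set E} (hS : S.Nonempty) {a : ℝ}
    (hk : Measurable k) (h0 : ∀ x, 0 ≤ k x) (h1 : ∀ x, k x ≤ 1)
    (h : ∀ x ∈ S, ∀ y ∈ S, a ≤ k (x - y)) : a ≤ sInf (energySet k S) := by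
  refine le_csInf ⟨_, energySet_nonempty hS⟩ ?_
  rintro _ ⟨μ, hμ, hμS, rfl⟩
  have hS' : ∀ᵐ x ∂μ, x ∈ S := by rwa [ae_iff]
  have key : ∀ y ∈ S, a ≤ ∫ x, k (x - y) ∂μ := by
    intro y hy
    have := integral_mono_ae (integrable_const a) (integrable_kernel (μ := μ) hk h0 h1 y)
      (hS'.mono fun x hx => h x hx y hy)
    simpa using this
  have := integral_mono_ae (integrable_const a) (integrable_potential (μ := μ) (ν := μ) hk h0 h1)
    (hS'.mono fun y hy => key y hy)
  simpa [kernelEnergy] using this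

/-- A near-minimizer of the energy has a potential that is nowhere small on `S`. -/
theorem exists_potential_ge [MeasurableSingletonClass E] {S : Set E} (hS : S.Nonempty)
    (hk : Measurable k) (h0 : ∀ x, 0 ≤ k x) (h1 : ∀ x, k x ≤ 1) (heven : ∀ x, k (-x) = k x)
    (hpos : 0 < sInf (energySet k S)) :
    ∃ μ : Measure E, IsProbabilityMeasure μ ∧ μ Sᶜ = 0 ∧
      ∀ x ∈ S, sInf (energySet k S) / 4 ≤ ∫ y, k (y - x) ∂μ := by
  set I := sInf (energySet k S) with hI
  have hI1 : I ≤ 1 := sInf_energySet_le_one hS h0 h1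
  -- If the potential at `z` were below `I / 4`, moving the fraction `I / 2` of the mass to `z`
  -- would give energy at most `(1 - I/2)² (I + I²/4) + I (1 - I/2) (I/4) + I²/4 = I - I²/4 - I³/8 +
  -- I⁴/16 < I`. The bound `k 0 ≤ 1` makes the point mass affordable at every `z`.
  obtain ⟨μ, hμ, hμS, hlt⟩ := exists_kernelEnergy_lt (k := k) hS (a := I + I ^ 2 / 4)
    (by rw [← hI]; nlinarith)
  refine ⟨μ, hμ, hμS, fun z hz => ?_⟩
  set P := ∫ y, k (y - z) ∂μ with hP
  -- the competitor
  set p : NNReal := ⟨1 - I / 2, by linarith⟩ with hp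
  set q : NNReal := ⟨I / 2, by linarith⟩ with hq
  have hpq : p + q = 1 := by exact Subtype.ext (sub_add_cancel 1 (I / 2))
  set ρ : Measure E := p • μ + q • Measure.dirac z with hρ
  have hρp : IsProbabilityMeasure ρ := by
    constructor
    rw [hρ, Measure.add_apply, Measure.smul_apply, Measure.smul_apply, measure_univ, measure_univ,
      ← add_smul, hpq, one_smul]
  have hρS : ρ Sᶜ = 0 := by
    have : (Measure.dirac z) Sᶜ = 0 := by rw [Measure.dirac_apply]; simp [hz]
    rw [hρ, Measure.add_apply, Measure.smul_apply, Measure.smul_apply, hμS, this]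
    simp
  have hle : I ≤ kernelEnergy k ρ := csInf_le (bddBelow_energySet h0 S) ⟨ρ, hρp, hρS, rfl⟩
  have hpot : ∀ y, ∫ x, k (x - y) ∂ρ = p * (∫ x, k (x - y) ∂μ) + q * k (z - y) := by
    intro y
    rw [hρ, integral_add_measure, integral_smul_nnreal_measure, integral_smul_nnreal_measure,
      integral_dirac]
    · rfl
    · exact (integrable_kernel hk h0 h1 y).smul_measure_nnreal
    · exact (integrable_kernel hk h0 h1 y).smul_measure_nnreal
  have hsym : ∫ y, k (z - y) ∂μ = P := by
    rw [hP]; congr 1; ext y; rw [← heven, neg_sub]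
  have hint1 : Integrable (fun y => ∫ x, k (x - y) ∂μ) μ := integrable_potential hk h0 h1
  have hint2 : Integrable (fun y => k (z - y)) μ := by
    refine (integrable_kernel (μ := μ) hk h0 h1 z).congr (Eventually.of_forall fun y => ?_)
    simp only
    rw [← heven, neg_sub]
  have hen : kernelEnergy k ρ
      = p * (p * kernelEnergy k μ + q * P) + q * (p * P + q * k 0) := by
    have hf : Integrable (fun y => (p : ℝ) * (∫ x, k (x - y) ∂μ) + q * k (z - y)) μ :=
      (hint1.const_mul _).add (hint2.const_mul _)
    unfold kernelEnergy
    simp_rw [hpot]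
    rw [hρ, integral_add_measure, integral_smul_nnreal_measure, integral_smul_nnreal_measure,
      integral_dirac, integral_add (hint1.const_mul _) (hint2.const_mul _), integral_const_mul,
      integral_const_mul, hsym, sub_self]
    · rfl
    · exact hf.smul_measure_nnreal
    · exact (integrable_dirac (by simp)).smul_measure_nnreal
  have hp' : (p : ℝ) = 1 - I / 2 := rfl
  have hq' : (q : ℝ) = I / 2 := rfl
  rw [hen, hp', hq'] at hle
  have hP0 : 0 ≤ P := integral_nonneg fun _ => h0 _
  have hk0 : k 0 ≤ 1 := h1 0
  have e1 : (1 - I / 2) * (1 - I / 2) * kernelEnergy k μ ≤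
      (1 - I / 2) * (1 - I / 2) * (I + I ^ 2 / 4) := by gcongr; nlinarith
  have e2 : I / 2 * (I / 2) * k 0 ≤ I / 2 * (I / 2) * 1 := by gcongr
  by_contra! hcon
  have e3 : (1 - I / 2) * (I / 2) * P ≤ (1 - I / 2) * (I / 2) * (I / 4) := by
    gcongr; nlinarith
  have hI2 : 0 < I ^ 2 := by positivity
  nlinarith [mul_pos hpos hI2, mul_pos hI2 hI2]

end Energy

/-! ### Capacities -/

section Capacity

variable {n : ℕ} {r r' θ θ' s s' m : ℝ} {F : Set (EuclideanSpace ℝ (Fin n))}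

theorem interKernel_eq (hr : 0 < r) (hr1 : r ≤ 1) (hθ : θ ≤ 1) :
    interKernel (n := n) r θ s m = fun x => radialKernel r θ s m ‖x‖ :=
  funext fun x => interKernel_eq_radialKernel hr hr1 hθ x

theorem measurable_interKernel (hr : 0 < r) (hr1 : r ≤ 1) (hθ : θ ≤ 1) (hs : 0 ≤ s)
    (hsm : s ≤ m) : Measurable (interKernel (n := n) r θ s m) := by
  rw [interKernel_eq hr hr1 hθ]
  exact ((continuous_radialKernel hr hs hsm).comp continuous_norm).measurable

theorem interKernel_nonneg (hr : 0 < r) (hr1 : r ≤ 1) (hθ : θ ≤ 1)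
    (x : EuclideanSpace ℝ (Fin n)) : 0 ≤ interKernel r θ s m x := by
  rw [interKernel_eq hr hr1 hθ]; exact (radialKernel_pos hr).le

theorem interKernel_le_one (hr : 0 < r) (hr1 : r ≤ 1) (hθ : θ ≤ 1) (hs : 0 ≤ s) (hsm : s ≤ m)
    (x : EuclideanSpace ℝ (Fin n)) : interKernel r θ s m x ≤ 1 := by
  rw [interKernel_eq hr hr1 hθ]; exact radialKernel_le_one hr hs hsm

theorem interKernel_neg (hr : 0 < r) (hr1 : r ≤ 1) (hθ : θ ≤ 1)
    (x : EuclideanSpace ℝ (Fin n)) : interKernel r θ s m (-x) = interKernel r θ s m x := by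
  simp [interKernel_eq hr hr1 hθ]

/-- The infimum of the energies: the reciprocal of the capacity. -/
noncomputable def interMinEnergy {n : ℕ} (r θ s m : ℝ) (F : Set (EuclideanSpace ℝ (Fin n))) : ℝ :=
  sInf (energySet (interKernel r θ s m) (closure F))

theorem interCapacity_eq : interCapacity r θ s m F = (interMinEnergy r θ s m F)⁻¹ := rfl

theorem Bornology.IsBounded.exists_norm_sub_le (hb : Bornology.IsBounded F) :
    ∃ D : ℝ, 1 ≤ D ∧ ∀ x ∈ closure F, ∀ y ∈ closure F, ‖x - y‖ ≤ D := by
  obtain ⟨D, hD⟩ := Metric.isBounded_iff.1 hb.closure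
  exact ⟨max D 1, le_max_right _ _, fun x hx y hy => by
    rw [← dist_eq_norm]; exact (hD hx hy).trans (le_max_left _ _)⟩

theorem le_interMinEnergy {D : ℝ} (hF : F.Nonempty) (hD1 : 1 ≤ D)
    (hD : ∀ x ∈ closure F, ∀ y ∈ closure F, ‖x - y‖ ≤ D) (hr : 0 < r) (hr1 : r ≤ 1)
    (hθ0 : 0 ≤ θ) (hθ : θ ≤ 1) (hs : 0 ≤ s) (hsm : s ≤ m) :
    r ^ (s + θ * (m - s)) / D ^ m ≤ interMinEnergy r θ s m F := by
  refine le_sInf_energySet hF.closure (measurable_interKernel hr hr1 hθ hs hsm)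
    (interKernel_nonneg hr hr1 hθ) (interKernel_le_one hr hr1 hθ hs hsm) fun x hx y hy => ?_
  rw [interKernel_eq hr hr1 hθ]
  exact le_radialKernel hr hr1 hθ0 hs hsm hD1 (hD x hx y hy)

theorem interMinEnergy_pos (hF : F.Nonempty) (hb : Bornology.IsBounded F) (hr : 0 < r)
    (hr1 : r ≤ 1) (hθ0 : 0 ≤ θ) (hθ : θ ≤ 1) (hs : 0 ≤ s) (hsm : s ≤ m) :
    0 < interMinEnergy r θ s m F := by
  obtain ⟨D, hD1, hD⟩ := hb.exists_norm_sub_le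
  refine lt_of_lt_of_le ?_ (le_interMinEnergy hF hD1 hD hr hr1 hθ0 hθ hs hsm)
  have : 0 < D := one_pos.trans_le hD1
  positivity

theorem interMinEnergy_le_one (hF : F.Nonempty) (hr : 0 < r)
    (hr1 : r ≤ 1) (hθ : θ ≤ 1) (hs : 0 ≤ s) (hsm : s ≤ m) :
    interMinEnergy r θ s m F ≤ 1 :=
  sInf_energySet_le_one hF.closure (interKernel_nonneg hr hr1 hθ)
    (interKernel_le_one hr hr1 hθ hs hsm)

theorem one_le_interCapacity (hF : F.Nonempty) (hb : Bornology.IsBounded F) (hr : 0 < r)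
    (hr1 : r ≤ 1) (hθ0 : 0 ≤ θ) (hθ : θ ≤ 1) (hs : 0 ≤ s) (hsm : s ≤ m) :
    1 ≤ interCapacity r θ s m F := by
  rw [interCapacity_eq]
  exact (one_le_inv₀ (interMinEnergy_pos hF hb hr hr1 hθ0 hθ hs hsm)).2
    (interMinEnergy_le_one hF hr hr1 hθ hs hsm)

theorem interCapacity_le {D : ℝ} (hF : F.Nonempty) (hD1 : 1 ≤ D)
    (hD : ∀ x ∈ closure F, ∀ y ∈ closure F, ‖x - y‖ ≤ D) (hr : 0 < r) (hr1 : r ≤ 1)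
    (hθ0 : 0 ≤ θ) (hθ : θ ≤ 1) (hs : 0 ≤ s) (hsm : s ≤ m) :
    interCapacity r θ s m F ≤ D ^ m * r ^ (-m) := by
  have hD0 : 0 < D := one_pos.trans_le hD1
  have h1 : 0 < r ^ m / D ^ m := by positivity
  have h2 : r ^ m / D ^ m ≤ interMinEnergy r θ s m F := by
    refine le_trans ?_ (le_interMinEnergy hF hD1 hD hr hr1 hθ0 hθ hs hsm)
    have : r ^ m ≤ r ^ (s + θ * (m - s)) :=
      Real.rpow_le_rpow_of_exponent_ge hr hr1 (by nlinarith)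
    gcongr
  rw [interCapacity_eq]
  refine (inv_anti₀ h1 h2).trans_eq ?_
  rw [inv_div, Real.rpow_neg hr.le, div_eq_mul_inv]

theorem interCapacity_le_mul (hF : F.Nonempty) (hb : Bornology.IsBounded F) {c : ℝ} (hc : 0 < c)
    (hr : 0 < r) (hr1 : r ≤ 1) (hθ0 : 0 ≤ θ) (hθ : θ ≤ 1) (hs : 0 ≤ s) (hsm : s ≤ m)
    (hr' : 0 < r') (hr1' : r' ≤ 1) (hθ0' : 0 ≤ θ') (hθ' : θ' ≤ 1) (hs' : 0 ≤ s') (hsm' : s' ≤ m)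
    (h : ∀ t, radialKernel r' θ' s' m t ≤ c * radialKernel r θ s m t) :
    interCapacity r θ s m F ≤ c * interCapacity r' θ' s' m F := by
  have h0 := interMinEnergy_pos hF hb hr hr1 hθ0 hθ hs hsm
  have h0' := interMinEnergy_pos hF hb hr' hr1' hθ0' hθ' hs' hsm'
  have key : interMinEnergy r' θ' s' m F ≤ c * interMinEnergy r θ s m F :=
    sInf_energySet_le_mul hF.closure (measurable_interKernel hr' hr1' hθ' hs' hsm')
      (interKernel_nonneg hr' hr1' hθ') (interKernel_le_one hr' hr1' hθ' hs' hsm')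
      (measurable_interKernel hr hr1 hθ hs hsm)
      (interKernel_nonneg hr hr1 hθ) (interKernel_le_one hr hr1 hθ hs hsm) hc
      fun x => by rw [interKernel_eq hr hr1 hθ, interKernel_eq hr' hr1' hθ']; exact h _
  rw [interCapacity_eq, interCapacity_eq, ← div_eq_mul_inv, le_div_iff₀ h0', inv_mul_le_iff₀ h0,
    mul_comm]
  exact key

theorem interCapacity_mono_exponent (hF : F.Nonempty) (hb : Bornology.IsBounded F)
    (hr : 0 < r) (hr1 : r ≤ 1) (hθ0 : 0 ≤ θ) (hθ : θ ≤ 1) (hs : 0 ≤ s) (hss : s ≤ s')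
    (hsm' : s' ≤ m) : interCapacity r θ s m F ≤ interCapacity r θ s' m F := by
  have := interCapacity_le_mul hF hb one_pos hr hr1 hθ0 hθ hs (hss.trans hsm') hr hr1 hθ0 hθ
    (hs.trans hss) hsm' fun t => by
      rw [one_mul]; exact radialKernel_antitone_exponent hr hss hr1 hθ
  simpa using this

theorem interCapacity_le_mul_exponent (hF : F.Nonempty) (hb : Bornology.IsBounded F)
    (hr : 0 < r) (hr1 : r ≤ 1) (hθ0 : 0 ≤ θ) (hθ : θ ≤ 1) (hs : 0 ≤ s) (hss : s ≤ s')
    (hsm' : s' ≤ m) :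
    interCapacity r θ s' m F ≤ r ^ (-((1 - θ) * (s' - s))) * interCapacity r θ s m F :=
  interCapacity_le_mul hF hb (Real.rpow_pos_of_pos hr _) hr hr1 hθ0 hθ (hs.trans hss) hsm'
    hr hr1 hθ0 hθ hs (hss.trans hsm') fun _ => radialKernel_le_mul_exponent hr hss

theorem interCapacity_le_mul_theta (hF : F.Nonempty) (hb : Bornology.IsBounded F)
    (hr : 0 < r) (hr1 : r ≤ 1) (hθ0 : 0 ≤ θ') (hθθ : θ' ≤ θ) (hθ : θ ≤ 1) (hs : 0 ≤ s)
    (hsm : s ≤ m) :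
    interCapacity r θ s m F ≤ r ^ (-((θ - θ') * (m - s))) * interCapacity r θ' s m F :=
  interCapacity_le_mul hF hb (Real.rpow_pos_of_pos hr _) hr hr1 (hθ0.trans hθθ) hθ hs hsm
    hr hr1 hθ0 (hθθ.trans hθ) hs hsm fun _ => radialKernel_le_mul_theta hr hθθ hr1 hsm

theorem interCapacity_anti_radius (hF : F.Nonempty) (hb : Bornology.IsBounded F)
    (hr : 0 < r) (hrr : r ≤ r') (hr1 : r' ≤ 1) (hθ0 : 0 ≤ θ) (hθ : θ ≤ 1) (hs : 0 ≤ s)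
    (hsm : s ≤ m) : interCapacity r' θ s m F ≤ interCapacity r θ s m F := by
  have := interCapacity_le_mul hF hb one_pos (hr.trans_le hrr) hr1 hθ0 hθ hs hsm hr
    (hrr.trans hr1) hθ0 hθ hs hsm fun t => by
      rw [one_mul]; exact radialKernel_mono_radius hr hrr hr1 hθ0 hθ hs hsm
  simpa using this

end Capacity

/-! ### Dimension profiles -/

/-- The function `g s - s` is continuous, changes sign on `[0, m]`, and is strictly decreasing
because `c < 1`. -/
theorem existsUnique_fixedPoint_of_slope {g : ℝ → ℝ} {m c : ℝ} (hm : 0 ≤ m) (hc : c < 1)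
    (hg : ∀ s t, 0 ≤ s → s ≤ t → t ≤ m → g s ≤ g t ∧ g t ≤ g s + c * (t - s))
    (h0 : 0 ≤ g 0) (h1 : g m ≤ m) : ∃! s, s ∈ Icc 0 m ∧ g s = s := by
  have hlip : LipschitzOnWith (Real.toNNReal |c|) g (Icc 0 m) := by
    have aux : ∀ s t, 0 ≤ s → s ≤ t → t ≤ m → |g s - g t| ≤ |c| * |s - t| := by
      intro s t h1 h2 h3
      obtain ⟨ha, hb⟩ := hg s t h1 h2 h3
      rw [abs_sub_comm, abs_of_nonneg (by linarith), abs_sub_comm, abs_of_nonneg (sub_nonneg.2 h2)]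
      nlinarith [le_abs_self c, sub_nonneg.2 h2]
    refine LipschitzOnWith.of_dist_le_mul fun s hs t ht => ?_
    rw [Real.coe_toNNReal _ (abs_nonneg c), Real.dist_eq, Real.dist_eq]
    rcases le_total s t with h | h
    · exact aux s t hs.1 h ht.2
    · rw [abs_sub_comm, abs_sub_comm s]
      exact aux t s ht.1 h hs.2
  have hcont : ContinuousOn (fun s => g s - s) (Icc 0 m) := hlip.continuousOn.sub continuousOn_id
  obtain ⟨s, hs, hs'⟩ := intermediate_value_Icc' hm hcont
    (show (0 : ℝ) ∈ Icc (g m - m) (g 0 - 0) from ⟨by linarith, by linarith⟩)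
  have hs' : g s = s := by simpa [sub_eq_zero] using hs'
  refine ⟨s, ⟨hs, hs'⟩, ?_⟩
  rintro t ⟨ht, ht'⟩
  rcases lt_trichotomy s t with h | h | h
  · have := (hg s t hs.1 h.le ht.2).2
    nlinarith
  · exact h.symm
  · have := (hg t s ht.1 h.le hs.2).2
    nlinarith

section Profile

variable {n : ℕ} {θ s s' m : ℝ} {F : Set (EuclideanSpace ℝ (Fin n))}

/-- The quotient whose lower and upper limits define the dimension profiles. -/
noncomputable def capacityRate {n : ℕ} (θ s m : ℝ) (F : Set (EuclideanSpace ℝ (Fin n))) (r : ℝ) :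
    ℝ := Real.log (interCapacity r θ s m F) / (-Real.log r)

theorem eventually_radius : ∀ᶠ r : ℝ in 𝓝[>] 0, 0 < r ∧ r < 1 :=
  Ioo_mem_nhdsGT one_pos

theorem capacityRate_nonneg (hF : F.Nonempty) (hb : Bornology.IsBounded F) (hθ0 : 0 ≤ θ)
    (hθ : θ ≤ 1) (hs : 0 ≤ s) (hsm : s ≤ m) : ∀ᶠ r in 𝓝[>] 0, 0 ≤ capacityRate θ s m F r := by
  filter_upwards [eventually_radius] with r ⟨h0, h1⟩
  exact div_nonneg (Real.log_nonneg (one_le_interCapacity hF hb h0 h1.le hθ0 hθ hs hsm))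
    (neg_nonneg.2 (Real.log_nonpos h0.le h1.le))

/-- On a set of diameter at most `D` the kernel is at least `r ^ m / D ^ m`; the constant `D ^ m`
disappears after division by `-log r`. -/
theorem exists_capacityRate_le (hF : F.Nonempty) (hb : Bornology.IsBounded F) (hθ0 : 0 ≤ θ)
    (hθ : θ ≤ 1) (hs : 0 ≤ s) (hsm : s ≤ m) :
    ∃ e : ℝ → ℝ, Tendsto e (𝓝[>] 0) (𝓝 m) ∧ ∀ᶠ r in 𝓝[>] 0, capacityRate θ s m F r ≤ e r := by
  obtain ⟨D, hD1, hD⟩ := hb.exists_norm_sub_le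
  refine ⟨fun r => Real.log (D ^ m) / (-Real.log r) + m, ?_, ?_⟩
  · have : Tendsto (fun r : ℝ => -Real.log r) (𝓝[>] 0) atTop :=
      tendsto_neg_atBot_atTop.comp Real.tendsto_log_nhdsGT_zero
    simpa using (this.const_div_atTop (Real.log (D ^ m))).add_const m
  · filter_upwards [eventually_radius] with r ⟨h0, h1⟩
    have hl : 0 < -Real.log r := neg_pos.2 (Real.log_neg h0 h1)
    have hC := one_le_interCapacity hF hb h0 h1.le hθ0 hθ hs hsm
    have h := Real.log_le_log (one_pos.trans_le hC)
      (interCapacity_le hF hD1 hD h0 h1.le hθ0 hθ hs hsm)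
    have hD0 : 0 < D := one_pos.trans_le hD1
    rw [Real.log_mul (Real.rpow_pos_of_pos hD0 m).ne' (Real.rpow_pos_of_pos h0 _).ne',
      Real.log_rpow h0] at h
    rw [capacityRate, div_le_iff₀ hl, add_mul, div_mul_cancel₀ _ hl.ne']
    linarith

theorem isBoundedUnder_le_capacityRate (hF : F.Nonempty) (hb : Bornology.IsBounded F)
    (hθ0 : 0 ≤ θ) (hθ : θ ≤ 1) (hs : 0 ≤ s) (hsm : s ≤ m) :
    IsBoundedUnder (· ≤ ·) (𝓝[>] 0) (capacityRate θ s m F) := by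
  obtain ⟨e, he, h⟩ := exists_capacityRate_le hF hb hθ0 hθ hs hsm
  exact he.isBoundedUnder_le.mono_le h

theorem isBoundedUnder_ge_capacityRate (hF : F.Nonempty) (hb : Bornology.IsBounded F)
    (hθ0 : 0 ≤ θ) (hθ : θ ≤ 1) (hs : 0 ≤ s) (hsm : s ≤ m) :
    IsBoundedUnder (· ≥ ·) (𝓝[>] 0) (capacityRate θ s m F) :=
  isBoundedUnder_of_eventually_ge (capacityRate_nonneg hF hb hθ0 hθ hs hsm)

theorem limsup_capacityRate_le (hF : F.Nonempty) (hb : Bornology.IsBounded F)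
    (hθ0 : 0 ≤ θ) (hθ : θ ≤ 1) (hs : 0 ≤ s) (hsm : s ≤ m) :
    limsup (capacityRate θ s m F) (𝓝[>] 0) ≤ m := by
  obtain ⟨e, he, h⟩ := exists_capacityRate_le hF hb hθ0 hθ hs hsm
  exact (limsup_le_limsup h
    (isBoundedUnder_ge_capacityRate hF hb hθ0 hθ hs hsm).isCoboundedUnder_le
    he.isBoundedUnder_le).trans he.limsup_eq.le

theorem le_liminf_capacityRate (hF : F.Nonempty) (hb : Bornology.IsBounded F)
    (hθ0 : 0 ≤ θ) (hθ : θ ≤ 1) (hs : 0 ≤ s) (hsm : s ≤ m) :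
    0 ≤ liminf (capacityRate θ s m F) (𝓝[>] 0) :=
  le_liminf_of_le (isBoundedUnder_le_capacityRate hF hb hθ0 hθ hs hsm).isCoboundedUnder_ge
    (capacityRate_nonneg hF hb hθ0 hθ hs hsm)

theorem liminf_le_limsup_capacityRate (hF : F.Nonempty) (hb : Bornology.IsBounded F)
    (hθ0 : 0 ≤ θ) (hθ : θ ≤ 1) (hs : 0 ≤ s) (hsm : s ≤ m) :
    liminf (capacityRate θ s m F) (𝓝[>] 0) ≤ limsup (capacityRate θ s m F) (𝓝[>] 0) :=
  liminf_le_limsup (isBoundedUnder_le_capacityRate hF hb hθ0 hθ hs hsm)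
    (isBoundedUnder_ge_capacityRate hF hb hθ0 hθ hs hsm)

theorem capacityRate_mono (hF : F.Nonempty) (hb : Bornology.IsBounded F)
    (hθ0 : 0 ≤ θ) (hθ : θ ≤ 1) (hs : 0 ≤ s) (hss : s ≤ s') (hsm : s' ≤ m) :
    ∀ᶠ r in 𝓝[>] 0, capacityRate θ s m F r ≤ capacityRate θ s' m F r := by
  filter_upwards [eventually_radius] with r ⟨h0, h1⟩
  have hl : 0 < -Real.log r := neg_pos.2 (Real.log_neg h0 h1)
  have hC := one_le_interCapacity hF hb h0 h1.le hθ0 hθ hs (hss.trans hsm)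
  have := Real.log_le_log (one_pos.trans_le hC)
    (interCapacity_mono_exponent hF hb h0 h1.le hθ0 hθ hs hss hsm)
  unfold capacityRate
  gcongr

theorem capacityRate_le_add (hF : F.Nonempty) (hb : Bornology.IsBounded F)
    (hθ0 : 0 ≤ θ) (hθ : θ ≤ 1) (hs : 0 ≤ s) (hss : s ≤ s') (hsm : s' ≤ m) :
    ∀ᶠ r in 𝓝[>] 0,
      capacityRate θ s' m F r ≤ capacityRate θ s m F r + (1 - θ) * (s' - s) := by
  filter_upwards [eventually_radius] with r ⟨h0, h1⟩
  have hl : 0 < -Real.log r := neg_pos.2 (Real.log_neg h0 h1)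
  have hC := one_le_interCapacity hF hb h0 h1.le hθ0 hθ hs (hss.trans hsm)
  have hC' := one_le_interCapacity hF hb h0 h1.le hθ0 hθ (hs.trans hss) hsm
  have := Real.log_le_log (one_pos.trans_le hC')
    (interCapacity_le_mul_exponent hF hb h0 h1.le hθ0 hθ hs hss hsm)
  rw [Real.log_mul (Real.rpow_pos_of_pos h0 _).ne' (one_pos.trans_le hC).ne',
    Real.log_rpow h0] at this
  unfold capacityRate
  rw [div_add' _ _ _ hl.ne']
  gcongr
  linarith

theorem existsUnique_isLowerProfile (hF : F.Nonempty) (hb : Bornology.IsBounded F)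
    (hθ0 : 0 < θ) (hθ : θ ≤ 1) (hm : 0 ≤ m) : ∃! s, IsLowerProfile θ m F s := by
  refine existsUnique_fixedPoint_of_slope
    (g := fun s => liminf (capacityRate θ s m F) (𝓝[>] 0)) (c := 1 - θ) hm (by linarith)
    (fun s t h0 hst htm => ⟨?_, ?_⟩) (le_liminf_capacityRate hF hb hθ0.le hθ le_rfl hm)
    ((liminf_le_limsup_capacityRate hF hb hθ0.le hθ hm le_rfl).trans
      (limsup_capacityRate_le hF hb hθ0.le hθ hm le_rfl))
  · exact liminf_le_liminf (capacityRate_mono hF hb hθ0.le hθ h0 hst htm)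
      (isBoundedUnder_ge_capacityRate hF hb hθ0.le hθ h0 (hst.trans htm))
      (isBoundedUnder_le_capacityRate hF hb hθ0.le hθ (h0.trans hst) htm).isCoboundedUnder_ge
  · have hle := isBoundedUnder_le_capacityRate hF hb hθ0.le hθ h0 (hst.trans htm)
    have hge := isBoundedUnder_ge_capacityRate hF hb hθ0.le hθ h0 (hst.trans htm)
    rw [← liminf_add_const _ _ _ hle.isCoboundedUnder_ge hge]
    exact liminf_le_liminf (capacityRate_le_add hF hb hθ0.le hθ h0 hst htm)
      (isBoundedUnder_ge_capacityRate hF hb hθ0.le hθ (h0.trans hst) htm)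
      (isBoundedUnder_le_add hle isBoundedUnder_const).isCoboundedUnder_ge

theorem existsUnique_isUpperProfile (hF : F.Nonempty) (hb : Bornology.IsBounded F)
    (hθ0 : 0 < θ) (hθ : θ ≤ 1) (hm : 0 ≤ m) : ∃! s, IsUpperProfile θ m F s := by
  refine existsUnique_fixedPoint_of_slope
    (g := fun s => limsup (capacityRate θ s m F) (𝓝[>] 0)) (c := 1 - θ) hm (by linarith)
    (fun s t h0 hst htm => ⟨?_, ?_⟩) ((le_liminf_capacityRate hF hb hθ0.le hθ le_rfl hm).trans
      (liminf_le_limsup_capacityRate hF hb hθ0.le hθ le_rfl hm))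
    (limsup_capacityRate_le hF hb hθ0.le hθ hm le_rfl)
  · exact limsup_le_limsup (capacityRate_mono hF hb hθ0.le hθ h0 hst htm)
      (isBoundedUnder_ge_capacityRate hF hb hθ0.le hθ h0 (hst.trans htm)).isCoboundedUnder_le
      (isBoundedUnder_le_capacityRate hF hb hθ0.le hθ (h0.trans hst) htm)
  · have hle := isBoundedUnder_le_capacityRate hF hb hθ0.le hθ h0 (hst.trans htm)
    have hge := isBoundedUnder_ge_capacityRate hF hb hθ0.le hθ h0 (hst.trans htm)
    rw [← limsup_add_const _ _ _ hle hge.isCoboundedUnder_le]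
    exact limsup_le_limsup (capacityRate_le_add hF hb hθ0.le hθ h0 hst htm)
      (isBoundedUnder_ge_capacityRate hF hb hθ0.le hθ (h0.trans hst) htm).isCoboundedUnder_le
      (isBoundedUnder_le_add hle isBoundedUnder_const)

theorem isLowerProfile_lowerProfile (hF : F.Nonempty) (hb : Bornology.IsBounded F)
    (hθ0 : 0 < θ) (hθ : θ ≤ 1) (hm : 0 ≤ m) : IsLowerProfile θ m F (lowerProfile θ m F) := by
  obtain ⟨s, hs, huniq⟩ := existsUnique_isLowerProfile hF hb hθ0 hθ hm
  have : {s | IsLowerProfile θ m F s} = {s} := by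
    ext t; exact ⟨fun h => huniq t h, fun h => by rw [mem_singleton_iff.1 h]; exact hs⟩
  rw [lowerProfile, this, csInf_singleton]
  exact hs

theorem isUpperProfile_upperProfile (hF : F.Nonempty) (hb : Bornology.IsBounded F)
    (hθ0 : 0 < θ) (hθ : θ ≤ 1) (hm : 0 ≤ m) : IsUpperProfile θ m F (upperProfile θ m F) := by
  obtain ⟨s, hs, huniq⟩ := existsUnique_isUpperProfile hF hb hθ0 hθ hm
  have : {s | IsUpperProfile θ m F s} = {s} := by
    ext t; exact ⟨fun h => huniq t h, fun h => by rw [mem_singleton_iff.1 h]; exact hs⟩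
  rw [upperProfile, this, csInf_singleton]
  exact hs

theorem interCapacity_lt_of_rate_lt (hF : F.Nonempty) (hb : Bornology.IsBounded F) (hθ0 : 0 ≤ θ)
    (hθ : θ ≤ 1) (hs : 0 ≤ s) (hsm : s ≤ m) {r a : ℝ} (h0 : 0 < r) (h1 : r < 1)
    (h : capacityRate θ s m F r < a) : interCapacity r θ s m F < r ^ (-a) := by
  have hl : 0 < -Real.log r := neg_pos.2 (Real.log_neg h0 h1)
  have hC := one_pos.trans_le (one_le_interCapacity hF hb h0 h1.le hθ0 hθ hs hsm)
  rw [capacityRate, div_lt_iff₀ hl] at h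
  rw [← Real.log_lt_log_iff hC (Real.rpow_pos_of_pos h0 _), Real.log_rpow h0]
  linarith

theorem lt_interCapacity_of_lt_rate (hF : F.Nonempty) (hb : Bornology.IsBounded F) (hθ0 : 0 ≤ θ)
    (hθ : θ ≤ 1) (hs : 0 ≤ s) (hsm : s ≤ m) {r a : ℝ} (h0 : 0 < r) (h1 : r < 1)
    (h : a < capacityRate θ s m F r) : r ^ (-a) < interCapacity r θ s m F := by
  have hl : 0 < -Real.log r := neg_pos.2 (Real.log_neg h0 h1)
  have hC := one_pos.trans_le (one_le_interCapacity hF hb h0 h1.le hθ0 hθ hs hsm)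
  rw [capacityRate, lt_div_iff₀ hl] at h
  rw [← Real.log_lt_log_iff (Real.rpow_pos_of_pos h0 _) hC, Real.log_rpow h0]
  linarith

theorem IsLowerProfile.frequently_lt (h : IsLowerProfile θ m F s) (hF : F.Nonempty)
    (hb : Bornology.IsBounded F) (hθ0 : 0 ≤ θ) (hθ : θ ≤ 1) {η : ℝ} (hη : 0 < η) :
    ∃ᶠ r in 𝓝[>] 0, interCapacity r θ s m F < r ^ (-(s + η)) := by
  have hlt : liminf (capacityRate θ s m F) (𝓝[>] 0) < s + η := by
    rw [show liminf (capacityRate θ s m F) (𝓝[>] 0) = s from h.2]; linarith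
  have := frequently_lt_of_liminf_lt
    (isBoundedUnder_le_capacityRate hF hb hθ0 hθ h.1.1 h.1.2).isCoboundedUnder_ge hlt
  exact (this.and_eventually eventually_radius).mono fun r hr =>
    interCapacity_lt_of_rate_lt hF hb hθ0 hθ h.1.1 h.1.2 hr.2.1 hr.2.2 hr.1

theorem IsLowerProfile.eventually_gt (h : IsLowerProfile θ m F s) (hF : F.Nonempty)
    (hb : Bornology.IsBounded F) (hθ0 : 0 ≤ θ) (hθ : θ ≤ 1) {η : ℝ} (hη : 0 < η) :
    ∀ᶠ r in 𝓝[>] 0, r ^ (-(s - η)) < interCapacity r θ s m F := by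
  have hlt : s - η < liminf (capacityRate θ s m F) (𝓝[>] 0) := by
    rw [show liminf (capacityRate θ s m F) (𝓝[>] 0) = s from h.2]; linarith
  have := eventually_lt_of_lt_liminf hlt
    (isBoundedUnder_ge_capacityRate hF hb hθ0 hθ h.1.1 h.1.2)
  exact (this.and eventually_radius).mono fun r hr =>
    lt_interCapacity_of_lt_rate hF hb hθ0 hθ h.1.1 h.1.2 hr.2.1 hr.2.2 hr.1

theorem IsUpperProfile.eventually_lt (h : IsUpperProfile θ m F s) (hF : F.Nonempty)
    (hb : Bornology.IsBounded F) (hθ0 : 0 ≤ θ) (hθ : θ ≤ 1) {η : ℝ} (hη : 0 < η) :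
    ∀ᶠ r in 𝓝[>] 0, interCapacity r θ s m F < r ^ (-(s + η)) := by
  have hlt : limsup (capacityRate θ s m F) (𝓝[>] 0) < s + η := by
    rw [show limsup (capacityRate θ s m F) (𝓝[>] 0) = s from h.2]; linarith
  have := eventually_lt_of_limsup_lt hlt
    (isBoundedUnder_le_capacityRate hF hb hθ0 hθ h.1.1 h.1.2)
  exact (this.and eventually_radius).mono fun r hr =>
    interCapacity_lt_of_rate_lt hF hb hθ0 hθ h.1.1 h.1.2 hr.2.1 hr.2.2 hr.1

theorem IsUpperProfile.frequently_gt (h : IsUpperProfile θ m F s) (hF : F.Nonempty)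
    (hb : Bornology.IsBounded F) (hθ0 : 0 ≤ θ) (hθ : θ ≤ 1) {η : ℝ} (hη : 0 < η) :
    ∃ᶠ r in 𝓝[>] 0, r ^ (-(s - η)) < interCapacity r θ s m F := by
  have hlt : s - η < limsup (capacityRate θ s m F) (𝓝[>] 0) := by
    rw [show limsup (capacityRate θ s m F) (𝓝[>] 0) = s from h.2]; linarith
  have := frequently_lt_of_lt_limsup
    (isBoundedUnder_ge_capacityRate hF hb hθ0 hθ h.1.1 h.1.2).isCoboundedUnder_le hlt
  exact (this.and_eventually eventually_radius).mono fun r hr =>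
    lt_interCapacity_of_lt_rate hF hb hθ0 hθ h.1.1 h.1.2 hr.2.1 hr.2.2 hr.1

end Profile

/-! ### Separated sets and covers by balls -/

section Separated

/-- Volume comparison: disjoint balls of radius `a / 2` lie in one ball of radius `R + a / 2`. -/
theorem card_le_of_separated_of_subset_closedBall {V : Type*} [NormedAddCommGroup V]
    [NormedSpace ℝ V] [FiniteDimensional ℝ V] (t : Finset V) {y : V} {R a : ℝ} (ha : 0 < a)
    (hR : 0 ≤ R) (ht : ∀ p ∈ t, dist p y ≤ R)
    (hsep : ∀ p ∈ t, ∀ q ∈ t, p ≠ q → a ≤ dist p q) :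
    (t.card : ℝ) ≤ (1 + 2 * R / a) ^ Module.finrank ℝ V := by
  borelize V
  let μ : Measure V := Measure.addHaar
  have hδ : 0 < a / 2 := by positivity
  have hρ : 0 < R + a / 2 := by positivity
  have D : Set.Pairwise (t : Set V) (Function.onFun Disjoint fun c => Metric.ball c (a / 2)) := by
    rintro c hc d hd hcd
    exact Metric.ball_disjoint_ball (by linarith [hsep c hc d hd hcd])
  have A_subset : (⋃ c ∈ t, Metric.ball c (a / 2)) ⊆ Metric.ball y (R + a / 2) :=
    iUnion₂_subset fun x hx => Metric.ball_subset_ball' (by linarith [ht x hx])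
  have I : (t.card : ℝ≥0∞) * ENNReal.ofReal ((a / 2) ^ Module.finrank ℝ V) *
      μ (Metric.ball 0 1) ≤
      ENNReal.ofReal ((R + a / 2) ^ Module.finrank ℝ V) * μ (Metric.ball 0 1) :=
    calc _ = μ (⋃ c ∈ t, Metric.ball c (a / 2)) := by
          rw [measure_biUnion_finset D fun c _ => measurableSet_ball]
          simp only [μ.addHaar_ball_of_pos _ hδ]
          simp only [Finset.sum_const, nsmul_eq_mul, mul_assoc]
      _ ≤ μ (Metric.ball y (R + a / 2)) := measure_mono A_subset
      _ = _ := by simp only [μ.addHaar_ball_of_pos _ hρ]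
  have J := (ENNReal.mul_le_mul_iff_left (Metric.measure_ball_pos μ _ zero_lt_one).ne'
    measure_ball_lt_top.ne).1 I
  have K := ENNReal.toReal_le_of_le_ofReal (pow_nonneg hρ.le _) J
  rw [ENNReal.toReal_mul, ENNReal.toReal_natCast,
    ENNReal.toReal_ofReal (pow_nonneg hδ.le _), ← le_div_iff₀ (pow_pos hδ _), ← div_pow] at K
  refine K.trans_eq ?_
  congr 1
  field_simp
  ring

/-- Counting inside `V` makes the exponent the dimension of `V` instead of that of the ambient
space. -/
theorem card_le_of_separated_of_mem_submodule {E : Type*} [NormedAddCommGroup E]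
    [NormedSpace ℝ E] [FiniteDimensional ℝ E] (V : Submodule ℝ E) (t : Finset E) {y : E}
    {R a : ℝ} (ha : 0 < a) (hR : 0 ≤ R) (htV : ∀ p ∈ t, p ∈ V) (hy : y ∈ V)
    (ht : ∀ p ∈ t, dist p y ≤ R) (hsep : ∀ p ∈ t, ∀ q ∈ t, p ≠ q → a ≤ dist p q) :
    (t.card : ℝ) ≤ (1 + 2 * R / a) ^ Module.finrank ℝ V := by
  classical
  have := card_le_of_separated_of_subset_closedBall (t.subtype (· ∈ V)) (y := ⟨y, hy⟩) ha hR
    (fun p hp => ht p (Finset.mem_subtype.1 hp))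
    (fun p hp q hq hpq => hsep p (Finset.mem_subtype.1 hp) q (Finset.mem_subtype.1 hq)
      fun h => hpq (Subtype.ext h))
  rwa [Finset.card_subtype, Finset.filter_true_of_mem htV] at this

theorem TotallyBounded.exists_separated_net {X : Type*} [MetricSpace X] {s : Set X}
    (hs : TotallyBounded s) {a : ℝ} (ha : 0 < a) :
    ∃ P : Finset X, ↑P ⊆ s ∧ (∀ p ∈ P, ∀ q ∈ P, p ≠ q → a ≤ dist p q) ∧
      s ⊆ ⋃ p ∈ P, Metric.closedBall p a := by
  -- Packing at scale `2 * b = a` is controlled by covering at scale `b`; this makes a maximal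
  -- `a`-separated set finite, and maximality makes it an `a`-net.
  obtain ⟨b, hb⟩ : ∃ b : NNReal, (b : ℝ) = a / 2 := ⟨⟨a / 2, by positivity⟩, rfl⟩
  have hb0 : b ≠ 0 := by
    rintro rfl
    rw [NNReal.coe_zero] at hb
    linarith
  obtain ⟨N, -, hNf, hN⟩ := Metric.exists_finite_isCover_of_totallyBounded hb0 hs
  have hpack : Metric.packingNumber (2 * b) s ≠ ⊤ := by
    refine ne_top_of_le_ne_top ?_ ((Metric.packingNumber_two_mul_le_externalCoveringNumber b s).trans
      hN.externalCoveringNumber_le_encard)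
    exact Set.encard_ne_top_iff.2 hNf
  have hfin : (Metric.maximalSeparatedSet (2 * b) s).Finite := by
    rw [← Set.encard_ne_top_iff, Metric.encard_maximalSeparatedSet hpack]
    exact hpack
  have hba : ((2 * b : NNReal) : ℝ) = a := by
    rw [NNReal.coe_mul, hb]; simp; ring
  refine ⟨hfin.toFinset, ?_, ?_, ?_⟩
  · rw [hfin.coe_toFinset]; exact Metric.maximalSeparatedSet_subset
  · intro p hp q hq hpq
    have : ((2 * b : NNReal) : ℝ≥0∞) < edist p q :=
      Metric.isSeparated_maximalSeparatedSet (hfin.mem_toFinset.1 hp)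
      (hfin.mem_toFinset.1 hq) hpq
    rw [edist_nndist, ENNReal.coe_lt_coe] at this
    rw [← hba, dist_nndist]
    exact_mod_cast this.le
  · have := Metric.isCover_iff_subset_iUnion_closedBall.1
      (Metric.isCover_maximalSeparatedSet hpack)
    simpa [hba] using this

end Separated

/-! ### Covers of projections built from a measure with large potential. -/

section Cover

variable {n m : ℕ}

theorem Grassmann.proj_mem (V : Grassmann n m) (x : EuclideanSpace ℝ (Fin n)) :
    V.proj x ∈ V.1 := Submodule.starProjection_apply_mem _ _

theorem Grassmann.norm_proj_le (V : Grassmann n m) (x : EuclideanSpace ℝ (Fin n)) :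
    ‖V.proj x‖ ≤ ‖x‖ := Submodule.norm_starProjection_apply_le _ _

/-- If every point of `A ⊆ V` carries much projected mass at scale `R`, then `A` has an efficient
cover by balls of a smaller diameter `τ`. -/
theorem Grassmann.exists_cover_of_mass (V : Grassmann n m) (μ : Measure (EuclideanSpace ℝ (Fin n)))
    [IsProbabilityMeasure μ] {A : Set (EuclideanSpace ℝ (Fin n))} (hAV : ∀ p ∈ A, p ∈ V.1)
    (hA : Bornology.IsBounded A) {R τ β : ℝ} (hτ : 0 < τ) (hτR : τ ≤ R)
    (hβ : ∀ p ∈ A, β ≤ μ.real {y | dist (V.proj y) p ≤ R}) :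
    ∃ P : Finset (EuclideanSpace ℝ (Fin n)), P.card * β ≤ (5 * (R / τ)) ^ m ∧
      A ⊆ ⋃ p ∈ P, Metric.closedBall p (τ / 2) := by
  classical
  obtain ⟨P, hPA, hsep, hcov⟩ :=
    (hA.isCompact_closure.totallyBounded.subset subset_closure).exists_separated_net
    (half_pos hτ)
  refine ⟨P, ?_, hcov⟩
  have hR : 0 < R := hτ.trans_le hτR
  have hmeas : ∀ p, MeasurableSet {y | dist (V.proj y) p ≤ R} := fun p =>
    (isClosed_le (V.proj.continuous.dist continuous_const) continuous_const).measurableSet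
  have hint : ∀ p ∈ P, Integrable (fun y =>
      {y | dist (V.proj y) p ≤ R}.indicator (1 : EuclideanSpace ℝ (Fin n) → ℝ) y) μ := fun p _ =>
    (integrable_indicator_iff (hmeas p)).2 (integrable_const (1 : ℝ)).integrableOn
  calc (P.card : ℝ) * β = ∑ p ∈ P, β := by simp
    _ ≤ ∑ p ∈ P, μ.real {y | dist (V.proj y) p ≤ R} :=
        Finset.sum_le_sum fun p hp => hβ p (hPA hp)
    _ = ∫ y, ∑ p ∈ P, ({y | dist (V.proj y) p ≤ R}.indicator 1 y : ℝ) ∂μ := by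
        rw [integral_finsetSum _ hint]
        exact Finset.sum_congr rfl fun p _ => (integral_indicator_one (hmeas p)).symm
    _ ≤ ∫ _, (5 * (R / τ)) ^ m ∂μ := by
        -- Pointwise, the sum counts the net points within `R` of `V.proj y`: these are `τ /
        -- 2`-separated points of `V`, whence the bound `(1 + 4 * R / τ) ^ m`, and `τ ≤ R` absorbs
        -- the `1`.
        refine integral_mono (integrable_finsetSum _ hint) (integrable_const _) fun y => ?_
        have h1 : ∑ p ∈ P, ({y | dist (V.proj y) p ≤ R}.indicator 1 y : ℝ)
            = ((P.filter fun p => dist p (V.proj y) ≤ R).card : ℝ) := by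
          rw [Finset.card_filter, Nat.cast_sum]
          refine Finset.sum_congr rfl fun p _ => ?_
          simp only [Set.indicator_apply, mem_ofPred_eq, dist_comm p]
          split_ifs <;> simp
        simp only
        rw [h1]
        refine (card_le_of_separated_of_mem_submodule V.1 _ (half_pos hτ) hR.le
          (fun p hp => hAV p (hPA (Finset.mem_filter.1 hp).1)) (V.proj_mem y)
          (fun p hp => (Finset.mem_filter.1 hp).2)
          fun p hp q hq => hsep p (Finset.mem_filter.1 hp).1 q (Finset.mem_filter.1 hq).1).trans ?_
        rw [V.2]
        refine pow_le_pow_left₀ (by positivity) ?_ m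
        have : 1 ≤ R / τ := (one_le_div hτ).2 hτR
        rw [show 2 * R / (τ / 2) = 4 * (R / τ) by field_simp; ring]
        linarith
    _ = (5 * (R / τ)) ^ m := by simp

/-- One term suffices: the least `k` with `z ≤ r * 2 ^ k`. By minimality `z` exceeds half of that
scale unless `k = 0`, so doubling costs a factor `2 ^ m`. -/
theorem radialKernel_le_sum_scales {r θ s m z : ℝ} (hr : 0 < r) (hs : 0 ≤ s) (hsm : s ≤ m)
    (hr1 : r ≤ 1) (hθ : θ ≤ 1) {N : ℕ} (hz : z ≤ r * 2 ^ N) :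
    radialKernel r θ s m z ≤ ∑ k ∈ Finset.range (N + 1),
      2 ^ m * radialKernel r θ s m (r * 2 ^ k) * (if z ≤ r * 2 ^ k then 1 else 0) := by
  classical
  have hnn : ∀ k ∈ Finset.range (N + 1), 0 ≤
      2 ^ m * radialKernel r θ s m (r * 2 ^ k) * (if z ≤ r * 2 ^ k then (1 : ℝ) else 0) := by
    intro k _
    have := radialKernel_pos (r := r) (θ := θ) (s := s) (m := m) (t := r * 2 ^ k) hr
    split_ifs <;> positivity
  have hex : ∃ k : ℕ, z ≤ r * 2 ^ k := ⟨N, hz⟩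
  have hk := Nat.find_spec hex
  have hkN : Nat.find hex ≤ N := Nat.find_min' hex hz
  refine le_trans ?_ (Finset.single_le_sum hnn (Finset.mem_range.2 (Nat.lt_succ_of_le hkN)))
  rw [if_pos hk, mul_one]
  rcases Nat.eq_zero_or_eq_succ_pred (Nat.find hex) with h | h
  · rw [h, pow_zero, mul_one, radialKernel_of_ge le_rfl hr hr1 hθ, mul_one]
    exact (radialKernel_le_one hr hs hsm).trans
      (Real.one_le_rpow one_le_two (hs.trans hsm))
  · have hlt : r * 2 ^ (Nat.find hex).pred < z :=
      not_le.1 (Nat.find_min hex (by rw [h]; exact Nat.lt_succ_self _))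
    refine (radialKernel_antitone hr hs hsm hlt.le).trans
      ((radialKernel_le_double hr hs hsm).trans_eq ?_)
    conv_rhs => rw [h]
    rw [Nat.succ_eq_add_one, pow_succ]
    congr 2
    ring

/-- The projection of `F` onto an `m`-dimensional subspace has covers with cost controlled by the
capacity of `F`. -/
theorem Grassmann.exists_cover_le_capacity {F : Set (EuclideanSpace ℝ (Fin n))}
    (hF : F.Nonempty) (hb : Bornology.IsBounded F) (V : Grassmann n m) {r θ s D : ℝ} (hr : 0 < r)
    (hr1 : r ≤ 1) (hθ0 : 0 ≤ θ) (hθ : θ ≤ 1) (hs : 0 ≤ s) (hsm : s ≤ m)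
    (hD : ∀ x ∈ closure F, ∀ y ∈ closure F, ‖x - y‖ ≤ D) {N : ℕ} (hN : D ≤ r * 2 ^ N) :
    ∃ (ι : Type) (T : Finset ι) (c : ι → EuclideanSpace ℝ (Fin n)) (d : ι → ℝ),
      (∀ i ∈ T, r ≤ d i ∧ d i ≤ r ^ θ) ∧
      V.proj '' F ⊆ ⋃ i ∈ T, Metric.closedBall (c i) (d i / 2) ∧
      ∑ i ∈ T, d i ^ s ≤ 4 * 10 ^ m * (N + 1) ^ 2 * (r ^ s * interCapacity r θ s m F) := by
  classical
  set I := interMinEnergy r θ s m F with hI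
  have hI0 : 0 < I := interMinEnergy_pos hF hb hr hr1 hθ0 hθ hs hsm
  obtain ⟨μ, hμ, hμF, hpot⟩ := exists_potential_ge hF.closure
    (measurable_interKernel (n := n) hr hr1 hθ hs hsm) (interKernel_nonneg hr hr1 hθ)
    (interKernel_le_one hr hr1 hθ hs hsm) (interKernel_neg hr hr1 hθ) hI0
  have hrθ : r ≤ r ^ θ := by simpa using Real.rpow_le_rpow_of_exponent_ge hr hr1 hθ
  set K : ℝ → ℝ := radialKernel r θ s m with hK
  set R : ℕ → ℝ := fun k => r * 2 ^ k with hR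
  have hRr : ∀ k, r ≤ R k := fun k => le_mul_of_one_le_right hr.le (one_le_pow₀ one_le_two)
  have hR0 : ∀ k, 0 < R k := fun k => hr.trans_le (hRr k)
  -- The largest admissible diameter not exceeding the scale `R k`.
  set τ : ℕ → ℝ := fun k => min (R k) (r ^ θ) with hτ
  have hτ0 : ∀ k, 0 < τ k := fun k => lt_min (hR0 k) (Real.rpow_pos_of_pos hr θ)
  have hKpos : ∀ t, 0 < K t := fun t => radialKernel_pos hr
  -- If all `N + 1` scales around a projected point carried mass below `β k`, the dyadic bound for
  -- the potential would sum to less than `I / 4`.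
  set β : ℕ → ℝ := fun k => I / (4 * (N + 1) * 2 ^ m * K (R k)) with hβ
  have hβ0 : ∀ k, 0 < β k := fun k => by have := hKpos (R k); positivity
  set S : ℕ → EuclideanSpace ℝ (Fin n) → Set (EuclideanSpace ℝ (Fin n)) :=
    fun k p => {y | dist (V.proj y) p ≤ R k} with hS
  have hSmeas : ∀ k p, MeasurableSet (S k p) := fun k p =>
    (isClosed_le (V.proj.continuous.dist continuous_const) continuous_const).measurableSet
  set A : ℕ → Set (EuclideanSpace ℝ (Fin n)) :=
    fun k => {p | p ∈ V.proj '' F ∧ β k ≤ μ.real (S k p)} with hA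
  have hAcov : ∀ x ∈ F, ∃ k ∈ Finset.range (N + 1), V.proj x ∈ A k := by
    intro x hx
    by_contra! hcon
    have hlt : ∀ k ∈ Finset.range (N + 1), μ.real (S k (V.proj x)) < β k := fun k hk =>
      not_le.1 fun h => hcon k hk ⟨mem_image_of_mem _ hx, h⟩
    have hint : ∀ k ∈ Finset.range (N + 1), Integrable (fun y =>
        2 ^ m * K (R k) * (S k (V.proj x)).indicator (1 : EuclideanSpace ℝ (Fin n) → ℝ) y) μ := fun k _ =>
      ((integrable_indicator_iff (hSmeas k _)).2
        (integrable_const (1 : ℝ)).integrableOn).const_mul _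
    have h1 : ∫ y, interKernel r θ s m (y - x) ∂μ ≤ ∫ y, ∑ k ∈ Finset.range (N + 1),
        2 ^ m * K (R k) * (S k (V.proj x)).indicator (1 : EuclideanSpace ℝ (Fin n) → ℝ) y ∂μ := by
      refine integral_mono_ae (integrable_kernel (measurable_interKernel hr hr1 hθ hs hsm)
        (interKernel_nonneg hr hr1 hθ) (interKernel_le_one hr hr1 hθ hs hsm) x)
        (integrable_finsetSum _ hint) ?_
      have hμF' : ∀ᵐ y ∂μ, y ∈ closure F := by rwa [ae_iff]
      filter_upwards [hμF'] with y hy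
      rw [interKernel_eq hr hr1 hθ]
      have hd : dist (V.proj y) (V.proj x) ≤ ‖y - x‖ := by
        rw [dist_eq_norm, ← map_sub]; exact V.norm_proj_le _
      refine (radialKernel_antitone hr hs hsm hd).trans
        ((radialKernel_le_sum_scales hr hs hsm hr1 hθ
          (hd.trans ((hD y hy x (subset_closure hx)).trans hN))).trans_eq ?_)
      refine Finset.sum_congr rfl fun k _ => ?_
      rw [Real.rpow_natCast]
      rfl
    rw [integral_finsetSum _ hint] at h1
    have h2 : ∑ k ∈ Finset.range (N + 1),
        ∫ y, 2 ^ m * K (R k) * (S k (V.proj x)).indicator (1 : EuclideanSpace ℝ (Fin n) → ℝ) y ∂μ < I / 4 := by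
      calc _ = ∑ k ∈ Finset.range (N + 1), 2 ^ m * K (R k) * μ.real (S k (V.proj x)) := by
            refine Finset.sum_congr rfl fun k _ => ?_
            rw [integral_const_mul, integral_indicator_one (hSmeas k _)]
        _ < ∑ k ∈ Finset.range (N + 1), 2 ^ m * K (R k) * β k := by
            refine Finset.sum_lt_sum_of_nonempty ⟨0, by simp⟩ fun k hk => ?_
            have := hKpos (R k)
            exact mul_lt_mul_of_pos_left (hlt k hk) (by positivity)
        _ = ∑ k ∈ Finset.range (N + 1), I / (4 * (N + 1)) := by
            refine Finset.sum_congr rfl fun k _ => ?_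
            have := (hKpos (R k)).ne'
            simp only [hβ]
            field_simp
        _ = I / 4 := by
            rw [Finset.sum_const, Finset.card_range, nsmul_eq_mul]
            push_cast
            field_simp
    exact absurd (hpot x (subset_closure hx)) (not_le.2 (h1.trans_lt h2))
  have hproj : Bornology.IsBounded (V.proj '' F) :=
    hb.image V.proj
  choose P hPcard hPcov using fun k => V.exists_cover_of_mass μ (A := A k) (β := β k)
    (fun p hp => by obtain ⟨x, -, rfl⟩ := hp.1; exact V.proj_mem x)
    (hproj.subset fun p hp => hp.1) (hτ0 k) (min_le_left (R k) (r ^ θ)) fun p hp => hp.2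
  refine ⟨_, (Finset.range (N + 1)).sigma P, fun i => i.2, fun i => τ i.1, ?_, ?_, ?_⟩
  · exact fun i _ => ⟨le_min (hRr _) hrθ, min_le_right _ _⟩
  · rintro _ ⟨x, hx, rfl⟩
    obtain ⟨k, hk, hxk⟩ := hAcov x hx
    obtain ⟨p, hp, hxp⟩ := mem_iUnion₂.1 (hPcov k hxk)
    exact mem_iUnion₂.2 ⟨⟨k, p⟩, Finset.mem_sigma.2 ⟨hk, hp⟩, hxp⟩
  · rw [Finset.sum_sigma]
    calc _ = ∑ k ∈ Finset.range (N + 1), (P k).card * τ k ^ s := by simp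
      _ ≤ ∑ k ∈ Finset.range (N + 1), 4 * 10 ^ m * (N + 1) * (r ^ s * I⁻¹) := by
          refine Finset.sum_le_sum fun k _ => ?_
          have hKk := hKpos (R k)
          -- The factor `K (R k)` from `1 / β k` cancels the dependence on the scale, so each of the
          -- `N + 1` scales contributes the same bound; hence the square of `N + 1`. The constant
          -- `10 ^ m` is `5 ^ m * 2 ^ m`.
          have hcost : K (R k) * ((R k / τ k) ^ (m : ℝ) * τ k ^ s) = r ^ s :=
            radialKernel_mul_cost hr (hRr k)
          rw [Real.rpow_natCast] at hcost
          have hc : (P k).card ≤ (5 * (R k / τ k)) ^ m / β k := (le_div_iff₀ (hβ0 k)).2 (hPcard k)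
          have hτs : 0 ≤ τ k ^ s := Real.rpow_nonneg (hτ0 k).le _
          calc (P k).card * τ k ^ s ≤ (5 * (R k / τ k)) ^ m / β k * τ k ^ s := by gcongr
            _ = 4 * 10 ^ m * (N + 1) * ((K (R k) * ((R k / τ k) ^ m * τ k ^ s)) * I⁻¹) := by
                simp only [hβ]
                rw [mul_pow 5, show (10 : ℝ) = 5 * 2 by norm_num, mul_pow 5]
                field_simp
            _ = _ := by rw [hcost]
      _ = _ := by
          rw [Finset.sum_const, Finset.card_range, nsmul_eq_mul, interCapacity_eq, ← hI]
          push_cast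
          ring

/-- In positive dimension a closed ball of radius `d / 2` has diameter exactly `d`, so the lower
bound on diameters is respected. -/
theorem thetaCover_of_finset [NeZero n] {F : Set (EuclideanSpace ℝ (Fin n))} {θ δ s ε : ℝ}
    {ι : Type} (T : Finset ι) (c : ι → EuclideanSpace ℝ (Fin n)) (d : ι → ℝ) (hδ : 0 < δ)
    (hd : ∀ i ∈ T, δ ^ (1 / θ) ≤ d i ∧ d i ≤ δ)
    (hcov : F ⊆ ⋃ i ∈ T, Metric.closedBall (c i) (d i / 2))
    (hsum : ∑ i ∈ T, d i ^ s ≤ ε) : ThetaCover F θ δ s ε := by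
  have hd0 : ∀ i ∈ T, 0 < d i := fun i hi =>
    (Real.rpow_pos_of_pos hδ _).trans_le (hd i hi).1
  have hdiam : ∀ i ∈ T, Metric.ediam (Metric.closedBall (c i) (d i / 2)) =
      ENNReal.ofReal (d i) := by
    intro i hi
    have h := Metric.diam_closedBall_eq (c i) (half_pos (hd0 i hi)).le
    rw [← ENNReal.ofReal_toReal (Metric.isBounded_closedBall
      (x := c i) (r := d i / 2)).ediam_ne_top]
    congr 1
    rw [← Metric.diam, h]
    ring
  set f : ι → Set (EuclideanSpace ℝ (Fin n)) := fun i => Metric.closedBall (c i) (d i / 2) with hf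
  refine ⟨f '' T, (T.finite_toSet.image f).countable, ?_, ?_, ?_⟩
  · rwa [sUnion_image]
  · rintro _ ⟨i, hi, rfl⟩
    rw [hdiam i hi]
    exact ⟨ENNReal.ofReal_le_ofReal (hd i hi).1, ENNReal.ofReal_le_ofReal (hd i hi).2⟩
  · have hsurj : Function.Surjective (fun i : (T : Set ι) =>
        (⟨f i, mem_image_of_mem f i.2⟩ : f '' (T : Set ι))) := by
      rintro ⟨_, i, hi, rfl⟩
      exact ⟨⟨i, hi⟩, rfl⟩
    -- Distinct indices may give the same ball, so the sum over the family of sets is only bounded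
    -- by the sum over indices.
    refine (ENNReal.tsum_le_tsum_comp_of_surjective hsurj _).trans ?_
    rw [Finset.tsum_subtype' T fun i => Metric.ediam (f i) ^ s]
    refine le_trans (le_of_eq ?_) (ENNReal.ofReal_le_ofReal hsum)
    rw [ENNReal.ofReal_sum_of_nonneg fun i hi => Real.rpow_nonneg (hd0 i hi).le _]
    exact Finset.sum_congr rfl fun i hi => by
      rw [hdiam i hi, ENNReal.ofReal_rpow_of_pos (hd0 i hi)]

end Cover

/-! ### Intermediate dimensions in terms of the scale `r = δ ^ (1 / θ)` -/

section Scale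

variable {X : Type*} [PseudoMetricSpace X] {F : Set X} {θ t ε : ℝ}

theorem tendsto_rpow_nhdsGT_zero {a : ℝ} (ha : 0 < a) :
    Tendsto (fun r : ℝ => r ^ a) (𝓝[>] 0) (𝓝[>] 0) := by
  refine tendsto_nhdsWithin_iff.2 ⟨?_, ?_⟩
  · have := (Real.continuousAt_rpow_const 0 a (Or.inr ha.le)).tendsto
    rw [Real.zero_rpow ha.ne'] at this
    exact this.mono_left nhdsWithin_le_nhds
  · filter_upwards [self_mem_nhdsWithin] with r hr using Real.rpow_pos_of_pos hr a

/-- The substitution `δ = r ^ θ` turns the range of diameters into `[r, r ^ θ]`, which matches the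
two thresholds of the kernel. -/
theorem eventually_thetaCover_iff (hθ : 0 < θ) :
    (∀ᶠ r in 𝓝[>] 0, ThetaCover F θ (r ^ θ) t ε) ↔
      ∃ δ₀ > 0, ∀ δ, 0 < δ → δ ≤ δ₀ → ThetaCover F θ δ t ε := by
  constructor
  · intro h
    have h' := (tendsto_rpow_nhdsGT_zero (one_div_pos.2 hθ)).eventually h
    obtain ⟨u, hu, hsub⟩ := mem_nhdsGT_iff_exists_Ioc_subset.1 h'
    refine ⟨u, hu, fun δ hδ hδu => ?_⟩
    have : ThetaCover F θ ((δ ^ (1 / θ)) ^ θ) t ε := hsub ⟨hδ, hδu⟩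
    rwa [← Real.rpow_mul hδ.le, one_div_mul_cancel hθ.ne', Real.rpow_one] at this
  · rintro ⟨δ₀, hδ₀, h⟩
    filter_upwards [(tendsto_rpow_nhdsGT_zero hθ).eventually (Ioc_mem_nhdsGT hδ₀)] with r hr
    exact h _ hr.1 hr.2

theorem frequently_thetaCover_iff (hθ : 0 < θ) :
    (∃ᶠ r in 𝓝[>] 0, ThetaCover F θ (r ^ θ) t ε) ↔
      ∀ δ₀ > 0, ∃ δ, 0 < δ ∧ δ ≤ δ₀ ∧ ThetaCover F θ δ t ε := by
  constructor
  · intro h δ₀ hδ₀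
    obtain ⟨r, hr, hr'⟩ := (h.and_eventually
      ((tendsto_rpow_nhdsGT_zero hθ).eventually (Ioc_mem_nhdsGT hδ₀))).exists
    exact ⟨_, hr'.1, hr'.2, hr⟩
  · intro h hcon
    obtain ⟨u, hu, hsub⟩ := mem_nhdsGT_iff_exists_Ioc_subset.1
      ((tendsto_rpow_nhdsGT_zero (one_div_pos.2 hθ)).eventually hcon)
    obtain ⟨δ, hδ, hδu, hc⟩ := h u hu
    have : ¬ ThetaCover F θ ((δ ^ (1 / θ)) ^ θ) t ε := hsub ⟨hδ, hδu⟩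
    rw [← Real.rpow_mul hδ.le, one_div_mul_cancel hθ.ne', Real.rpow_one] at this
    exact this hc

theorem bddBelow_lowerInterDim_set : BddBelow {s : ℝ | 0 ≤ s ∧ ∀ ε > 0, ∀ δ₀ > 0,
    ∃ δ, 0 < δ ∧ δ ≤ δ₀ ∧ ThetaCover F θ δ s ε} := ⟨0, fun _ h => h.1⟩

theorem bddBelow_upperInterDim_set : BddBelow {s : ℝ | 0 ≤ s ∧ ∀ ε > 0, ∃ δ₀ > 0,
    ∀ δ, 0 < δ → δ ≤ δ₀ → ThetaCover F θ δ s ε} := ⟨0, fun _ h => h.1⟩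

end Scale

/-! ### Upper bounds for the intermediate dimensions of projections -/

/-- The number of dyadic scales is bounded by an affine function of `log r`; any positive power of
`r` beats it. -/
theorem tendsto_affine_log_mul_rpow (a b : ℝ) {κ : ℝ} (hκ : 0 < κ) :
    Tendsto (fun r : ℝ => (a + b * Real.log r) * r ^ κ) (𝓝[>] 0) (𝓝 0) := by
  have h1 := ((tendsto_rpow_nhdsGT_zero hκ).mono_right nhdsWithin_le_nhds).const_mul a
  have h2 := (tendsto_log_mul_rpow_nhdsGT_zero hκ).const_mul b
  have h3 := h1.add h2
  simp only [mul_zero, add_zero] at h3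
  exact h3.congr fun r => by ring

section UpperBound

variable {n m : ℕ} {F : Set (EuclideanSpace ℝ (Fin n))} {θ s t : ℝ}

/-- Diameters are at most `r ^ θ`, so going from exponent `s` to `t` gains `r ^ (θ * (t - s))`. The
capacity hypothesis spends half of that gain, and the other half absorbs the squared number of
scales. -/
theorem Grassmann.eventually_thetaCover [NeZero n] (hF : F.Nonempty) (hb : Bornology.IsBounded F)
    (V : Grassmann n m) (hθ0 : 0 < θ) (hθ : θ ≤ 1) (hs : 0 ≤ s) (hsm : s ≤ m) (hst : s < t) {ε : ℝ}
    (hε : 0 < ε) :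
    ∀ᶠ r in 𝓝[>] 0, interCapacity r θ s m F < r ^ (-(s + θ * (t - s) / 2)) →
      ThetaCover (V.proj '' F) θ (r ^ θ) t ε := by
  obtain ⟨D, hD1, hD⟩ := hb.exists_norm_sub_le
  set η := θ * (t - s) / 2 with hη
  have hη0 : 0 < η := by have := sub_pos.2 hst; positivity
  have hlim := ((tendsto_affine_log_mul_rpow (Real.log D / Real.log 2 + 2) (-(1 / Real.log 2))
    (half_pos hη0)).pow 2).const_mul (4 * 10 ^ m)
  simp only [ne_eq, OfNat.ofNat_ne_zero, not_false_eq_true, zero_pow, mul_zero] at hlim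
  filter_upwards [eventually_radius, hlim.eventually (gt_mem_nhds hε)] with r ⟨h0, h1⟩ hsmall hC
  have hD0 : 0 < D := one_pos.trans_le hD1
  have hl2 : 0 < Real.log 2 := Real.log_pos one_lt_two
  set x := Real.log (D / r) / Real.log 2 with hx
  have hx0 : 0 ≤ x := div_nonneg (Real.log_nonneg ((one_le_div h0).2 (h1.le.trans hD1))) hl2.le
  obtain ⟨N, hN1, hN2⟩ : ∃ N : ℕ, x ≤ N ∧ (N : ℝ) < x + 1 :=
    ⟨⌈x⌉₊, Nat.le_ceil x, Nat.ceil_lt_add_one hx0⟩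
  have hDN : D ≤ r * 2 ^ N := by
    rw [← div_le_iff₀' h0, ← Real.log_le_log_iff (div_pos hD0 h0) (by positivity), Real.log_pow]
    rwa [hx, div_le_iff₀ hl2] at hN1
  obtain ⟨ι, T, c, d, hd, hcov, hsum⟩ :=
    V.exists_cover_le_capacity hF hb h0 h1.le hθ0.le hθ hs hsm hD hDN
  have hrθ : (r ^ θ) ^ (1 / θ) = r := by
    rw [← Real.rpow_mul h0.le, mul_one_div_cancel hθ0.ne', Real.rpow_one]
  refine thetaCover_of_finset T c d (Real.rpow_pos_of_pos h0 θ) (by rwa [hrθ]) hcov ?_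
  have hterm : ∀ i ∈ T, d i ^ t ≤ r ^ (θ * (t - s)) * d i ^ s := by
    intro i hi
    have hdi : 0 < d i := h0.trans_le (hd i hi).1
    rw [show t = (t - s) + s by ring, Real.rpow_add hdi, add_sub_cancel_right, Real.rpow_mul h0.le]
    have := Real.rpow_le_rpow hdi.le (hd i hi).2 (sub_nonneg.2 hst.le)
    gcongr
  have hNx : (N : ℝ) + 1 ≤ Real.log D / Real.log 2 + 2 + -(1 / Real.log 2) * Real.log r := by
    have : x = Real.log D / Real.log 2 + -(1 / Real.log 2) * Real.log r := by
      rw [hx, Real.log_div hD0.ne' h0.ne']; ring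
    linarith
  calc ∑ i ∈ T, d i ^ t ≤ ∑ i ∈ T, r ^ (θ * (t - s)) * d i ^ s := Finset.sum_le_sum hterm
    _ = r ^ (θ * (t - s)) * ∑ i ∈ T, d i ^ s := by rw [Finset.mul_sum]
    _ ≤ r ^ (θ * (t - s)) * (4 * 10 ^ m * (N + 1) ^ 2 * (r ^ s * r ^ (-(s + η)))) := by
        have hp := Real.rpow_pos_of_pos h0 (θ * (t - s))
        have hp' := Real.rpow_pos_of_pos h0 s
        refine mul_le_mul_of_nonneg_left (hsum.trans ?_) hp.le
        gcongr
    _ = 4 * 10 ^ m * ((N + 1) * r ^ (η / 2)) ^ 2 := by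
        have e : r ^ (θ * (t - s)) * (r ^ s * r ^ (-(s + η))) = r ^ (η / 2) * r ^ (η / 2) := by
          rw [← Real.rpow_add h0, ← Real.rpow_add h0, ← Real.rpow_add h0]
          congr 1
          rw [hη]; ring
        linear_combination (4 * 10 ^ m * ((N : ℝ) + 1) ^ 2) * e
    _ ≤ 4 * 10 ^ m * ((Real.log D / Real.log 2 + 2 + -(1 / Real.log 2) * Real.log r)
          * r ^ (η / 2)) ^ 2 := by
        have hp := Real.rpow_pos_of_pos h0 (η / 2)
        gcongr
    _ ≤ ε := hsmall.le

theorem IsLowerProfile.mem_lowerInterDim_set [NeZero n] (h : IsLowerProfile θ m F s)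
    (hF : F.Nonempty) (hb : Bornology.IsBounded F) (V : Grassmann n m) (hθ0 : 0 < θ) (hθ : θ ≤ 1)
    (hst : s < t) : 0 ≤ t ∧ ∀ ε > 0, ∀ δ₀ > 0,
      ∃ δ, 0 < δ ∧ δ ≤ δ₀ ∧ ThetaCover (V.proj '' F) θ δ t ε := by
  refine ⟨h.1.1.trans hst.le, fun ε hε => (frequently_thetaCover_iff hθ0).1 ?_⟩
  exact ((h.frequently_lt hF hb hθ0.le hθ (η := θ * (t - s) / 2)
    (by have := sub_pos.2 hst; positivity)).and_eventually
    (V.eventually_thetaCover hF hb hθ0 hθ h.1.1 h.1.2 hst hε)).mono fun r hr => hr.2 hr.1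

theorem IsUpperProfile.mem_upperInterDim_set [NeZero n] (h : IsUpperProfile θ m F s)
    (hF : F.Nonempty) (hb : Bornology.IsBounded F) (V : Grassmann n m) (hθ0 : 0 < θ) (hθ : θ ≤ 1)
    (hst : s < t) : 0 ≤ t ∧ ∀ ε > 0, ∃ δ₀ > 0,
      ∀ δ, 0 < δ → δ ≤ δ₀ → ThetaCover (V.proj '' F) θ δ t ε := by
  refine ⟨h.1.1.trans hst.le, fun ε hε => (eventually_thetaCover_iff hθ0).1 ?_⟩
  exact ((h.eventually_lt hF hb hθ0.le hθ (η := θ * (t - s) / 2)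
    (by have := sub_pos.2 hst; positivity)).and
    (V.eventually_thetaCover hF hb hθ0 hθ h.1.1 h.1.2 hst hε)).mono fun r hr => hr.2 hr.1

theorem IsLowerProfile.lowerInterDim_proj_le [NeZero n] (h : IsLowerProfile θ m F s)
    (hF : F.Nonempty) (hb : Bornology.IsBounded F) (V : Grassmann n m) (hθ0 : 0 < θ) (hθ : θ ≤ 1) :
    lowerInterDim θ (V.proj '' F) ≤ s :=
  le_of_forall_gt_imp_ge_of_dense fun _ ht =>
    csInf_le bddBelow_lowerInterDim_set (h.mem_lowerInterDim_set hF hb V hθ0 hθ ht)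

theorem IsUpperProfile.upperInterDim_proj_le [NeZero n] (h : IsUpperProfile θ m F s)
    (hF : F.Nonempty) (hb : Bornology.IsBounded F) (V : Grassmann n m) (hθ0 : 0 < θ) (hθ : θ ≤ 1) :
    upperInterDim θ (V.proj '' F) ≤ s :=
  le_of_forall_gt_imp_ge_of_dense fun _ ht =>
    csInf_le bddBelow_upperInterDim_set (h.mem_upperInterDim_set hF hb V hθ0 hθ ht)

end UpperBound

/-! ### The distribution of the projection of a vector onto a random subspace -/

instance OrthGroup.instIsMulLeftInvariant (n : ℕ) : (OrthGroup.haar n).IsMulLeftInvariant :=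
  inferInstanceAs (Measure.haarMeasure ⊤ : Measure (OrthGroup n)).IsMulLeftInvariant

section RandomSubspace

variable {n m : ℕ}

/-- The natural action of `O(n)` on `ℝⁿ`. -/
noncomputable def OrthGroup.act (g : OrthGroup n) :
    EuclideanSpace ℝ (Fin n) ≃ₗᵢ[ℝ] EuclideanSpace ℝ (Fin n) :=
  Unitary.linearIsometryEquiv g

theorem OrthGroup.act_mul (g h : OrthGroup n) (x : EuclideanSpace ℝ (Fin n)) :
    (g * h).act x = g.act (h.act x) := by
  rw [OrthGroup.act, map_mul]; rfl

theorem OrthGroup.continuous_act_inv :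
    Continuous fun p : EuclideanSpace ℝ (Fin n) × OrthGroup n => (p.2⁻¹).act p.1 := by
  have h : Continuous fun p : EuclideanSpace ℝ (Fin n) × OrthGroup n =>
      ((p.2⁻¹ : OrthGroup n) : EuclideanSpace ℝ (Fin n) →L[ℝ] EuclideanSpace ℝ (Fin n)) :=
    continuous_subtype_val.comp (continuous_inv.comp continuous_snd)
  exact h.clm_apply continuous_fst

/-- The reflection in the hyperplane orthogonal to `x - y` carries `x` to `y`. -/
theorem OrthGroup.exists_act_eq {x y : EuclideanSpace ℝ (Fin n)} (h : ‖x‖ = ‖y‖) :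
    ∃ g : OrthGroup n, g.act x = y := by
  refine ⟨Unitary.linearIsometryEquiv.symm (Submodule.reflection (ℝ ∙ (x - y))ᗮ), ?_⟩
  rw [OrthGroup.act, MulEquiv.apply_symm_apply]
  exact Submodule.reflection_sub h

theorem Grassmann.norm_proj_image (V : Grassmann n m) (g : OrthGroup n)
    (x : EuclideanSpace ℝ (Fin n)) : ‖(V.image g).proj x‖ = ‖V.proj ((g⁻¹).act x)‖ := by
  have h : (V.image g).proj x = g.act (V.proj (g.act.symm x)) :=
    Submodule.starProjection_map_apply (Unitary.linearIsometryEquiv g) V.1 x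
  rw [h, LinearIsometryEquiv.norm_map]
  rfl

/-- The law of the length of the projection of `g⁻¹ x` depends only on `‖x‖`. -/
theorem OrthGroup.haar_norm_proj_act_eq (V : Grassmann n m) {x y : EuclideanSpace ℝ (Fin n)}
    (h : ‖x‖ = ‖y‖) (R : ℝ) :
    OrthGroup.haar n {g | ‖V.proj ((g⁻¹).act x)‖ ≤ R} =
      OrthGroup.haar n {g | ‖V.proj ((g⁻¹).act y)‖ ≤ R} := by
  obtain ⟨k, rfl⟩ := OrthGroup.exists_act_eq h
  -- Left translation by `k⁻¹` replaces `g⁻¹ x` by `g⁻¹ (k x)`.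
  rw [← measure_preimage_mul (OrthGroup.haar n) k⁻¹ {g | ‖V.proj ((g⁻¹).act x)‖ ≤ R}]
  congr 1
  ext g
  simp only [mem_preimage, mem_ofPred_eq, mul_inv_rev, inv_inv, OrthGroup.act_mul]

theorem Grassmann.abs_apply_le_norm_proj_base (h : m ≤ n) (z : EuclideanSpace ℝ (Fin n))
    {i : Fin n} (hi : (i : ℕ) < m) : |z i| ≤ ‖(Grassmann.base h).proj z‖ := by
  set e := EuclideanSpace.basisFun (Fin n) ℝ i with he
  have hmem : e ∈ (Grassmann.base h).1 :=
    Submodule.subset_span ⟨⟨i, hi⟩, rfl⟩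
  have h1 : inner ℝ e z = inner ℝ e ((Grassmann.base h).proj z) := by
    have hp : (Grassmann.base h).1.starProjection e = e :=
      Submodule.starProjection_eq_self_iff.2 hmem
    conv_lhs => rw [← hp]
    exact Submodule.inner_starProjection_left_eq_right _ _ _
  have h2 : z i = inner ℝ e z := by
    rw [he, EuclideanSpace.basisFun_inner]
  rw [h2, h1]
  refine (abs_real_inner_le_norm _ _).trans_eq ?_
  rw [he, (EuclideanSpace.basisFun (Fin n) ℝ).orthonormal.1 i, one_mul]

/-- The set lies in a box with `m` sides of length `2 * R` and `n - m` sides of length `2 * ρ`. -/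
theorem Grassmann.volume_norm_proj_base_le (h : m ≤ n) {ρ R : ℝ} (hρ : 0 ≤ ρ) (hR : 0 ≤ R) :
    volume (Metric.closedBall (0 : EuclideanSpace ℝ (Fin n)) ρ ∩
      {z | ‖(Grassmann.base h).proj z‖ ≤ R}) ≤ ENNReal.ofReal (2 ^ n * R ^ m * ρ ^ (n - m)) := by
  set a : Fin n → ℝ := fun i => if (i : ℕ) < m then R else ρ with ha
  have ha0 : ∀ i, 0 ≤ a i := fun i => by simp only [ha]; split_ifs <;> assumption
  have hsub : Metric.closedBall (0 : EuclideanSpace ℝ (Fin n)) ρ ∩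
      {z | ‖(Grassmann.base h).proj z‖ ≤ R} ⊆
      (WithLp.ofLp : EuclideanSpace ℝ (Fin n) → _) ⁻¹' (Icc (-a) a) := by
    rintro z ⟨hz1, hz2⟩
    have key : ∀ i, |z i| ≤ a i := by
      intro i
      simp only [ha]
      split_ifs with hi
      · exact (Grassmann.abs_apply_le_norm_proj_base h z hi).trans hz2
      · exact (PiLp.norm_apply_le z i).trans (mem_closedBall_zero_iff.1 hz1)
    exact ⟨fun i => (abs_le.1 (key i)).1, fun i => (abs_le.1 (key i)).2⟩
  have hprod : ∏ i, (a i - (-a) i) = 2 ^ n * R ^ m * ρ ^ (n - m) := by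
    have h1 : (Finset.univ.filter fun i : Fin n => (i : ℕ) < m).card = m := by
      rw [Fin.card_filter_val_lt, min_eq_right h]
    have h2 : (Finset.univ.filter fun i : Fin n => ¬ (i : ℕ) < m).card = n - m := by
      have := Finset.card_filter_add_card_filter_not (s := Finset.univ)
        (fun i : Fin n => (i : ℕ) < m)
      rw [h1, Finset.card_univ, Fintype.card_fin] at this
      omega
    have h3 : ∏ i, a i = R ^ m * ρ ^ (n - m) := by
      simp only [ha]
      rw [Finset.prod_ite, Finset.prod_const, Finset.prod_const, h1, h2]
    calc ∏ i, (a i - (-a) i) = ∏ i, 2 * a i :=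
          Finset.prod_congr rfl fun i _ => by simp only [Pi.neg_apply]; ring
      _ = _ := by
          rw [Finset.prod_mul_distrib, h3, Finset.prod_const, Finset.card_univ, Fintype.card_fin,
            mul_assoc]
  refine (measure_mono hsub).trans ?_
  rw [(PiLp.volume_preserving_ofLp (Fin n)).measure_preimage
    measurableSet_Icc.nullMeasurableSet, Real.volume_Icc_pi,
    ← ENNReal.ofReal_prod_of_nonneg fun i _ => ?_, hprod]
  have := ha0 i
  simp only [Pi.neg_apply]
  linarith

/-- Comparison of the measure of the set of bad rotations with a volume, by Fubini's theorem. -/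
theorem OrthGroup.haar_mul_volume_le (h : m ≤ n) {x : EuclideanSpace ℝ (Fin n)} {R : ℝ} :
    OrthGroup.haar n {g | ‖(Grassmann.base h).proj ((g⁻¹).act x)‖ ≤ R} *
        volume (Metric.closedBall (0 : EuclideanSpace ℝ (Fin n)) ‖x‖) ≤
      volume (Metric.closedBall (0 : EuclideanSpace ℝ (Fin n)) ‖x‖ ∩
        {z | ‖(Grassmann.base h).proj z‖ ≤ R}) := by
  set V := Grassmann.base h
  set B := Metric.closedBall (0 : EuclideanSpace ℝ (Fin n)) ‖x‖ with hB
  set S : Set (EuclideanSpace ℝ (Fin n) × OrthGroup n) :=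
    {p | ‖V.proj ((p.2⁻¹).act p.1)‖ ≤ R} with hS
  have hSm : MeasurableSet S := (isClosed_le
    (V.proj.continuous.comp OrthGroup.continuous_act_inv).norm continuous_const).measurableSet
  have h1 : ((volume.restrict B).prod (OrthGroup.haar n)) S
      = ∫⁻ z in B, OrthGroup.haar n {g | ‖V.proj ((g⁻¹).act z)‖ ≤ R} :=
    Measure.prod_apply hSm
  have h2 : ((volume.restrict B).prod (OrthGroup.haar n)) S
      = ∫⁻ g, (volume.restrict B) {z | ‖V.proj ((g⁻¹).act z)‖ ≤ R} ∂(OrthGroup.haar n) :=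
    Measure.prod_apply_symm hSm
  -- Rotations preserve both the ball and Lebesgue measure, so the inner integral does not depend on
  -- `g`.
  have h3 : ∀ g : OrthGroup n, (volume.restrict B) {z | ‖V.proj ((g⁻¹).act z)‖ ≤ R} =
      volume (B ∩ {z | ‖V.proj z‖ ≤ R}) := by
    intro g
    have hm : MeasurableSet {z | ‖V.proj z‖ ≤ R} :=
      (isClosed_le V.proj.continuous.norm continuous_const).measurableSet
    have hBm : MeasurableSet B := Metric.isClosed_closedBall.measurableSet
    rw [Measure.restrict_apply' hBm,
      ← ((g⁻¹).act.measurePreserving).measure_preimage (hBm.inter hm).nullMeasurableSet]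
    congr 1
    ext z
    simp only [hB, mem_inter_iff, mem_ofPred_eq, mem_preimage, mem_closedBall_zero_iff,
      LinearIsometryEquiv.norm_map]
    exact and_comm
  -- The law depends only on the norm, so `z` may be replaced by a multiple of `x` with factor at
  -- most `1`, and shrinking a vector shortens its projection.
  have h4 : ∫⁻ _ in B, OrthGroup.haar n {g | ‖V.proj ((g⁻¹).act x)‖ ≤ R} ≤
      ∫⁻ z in B, OrthGroup.haar n {g | ‖V.proj ((g⁻¹).act z)‖ ≤ R} := by
    refine setLIntegral_mono' Metric.isClosed_closedBall.measurableSet fun z hz => ?_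
    rcases eq_or_ne x 0 with rfl | hx
    · have : z = 0 := by simpa [hB] using hz
      rw [this]
    have hx0 : 0 < ‖x‖ := norm_pos_iff.2 hx
    have hz1 : ‖z‖ / ‖x‖ ≤ 1 := (div_le_one hx0).2 (mem_closedBall_zero_iff.1 hz)
    have hn : ‖(‖z‖ / ‖x‖) • x‖ = ‖z‖ := by
      rw [norm_smul, Real.norm_of_nonneg (by positivity), div_mul_cancel₀ _ hx0.ne']
    rw [← OrthGroup.haar_norm_proj_act_eq V hn R]
    refine measure_mono fun g hg => ?_
    simp only [mem_ofPred_eq] at hg ⊢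
    rw [map_smul, map_smul, norm_smul, Real.norm_of_nonneg (by positivity)]
    exact (mul_le_of_le_one_left (norm_nonneg _) hz1).trans hg
  rw [setLIntegral_const, ← h1, h2] at h4
  simp_rw [h3] at h4
  rwa [lintegral_const, measure_univ, mul_one] at h4

theorem measurableSet_norm_proj_le (x : EuclideanSpace ℝ (Fin n)) (R : ℝ) :
    MeasurableSet {V : Grassmann n m | ‖V.proj x‖ ≤ R} := by
  have : Continuous fun V : Grassmann n m => ‖V.proj x‖ :=
    (continuous_induced_dom.clm_apply continuous_const).norm
  exact (isClosed_le this continuous_const).measurableSet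

/-- A random `m`-dimensional subspace is nearly orthogonal to `x` with small probability. -/
theorem exists_grassmannMeasure_norm_proj_le [NeZero n] (h : m ≤ n) : ∃ c : ℝ, 1 ≤ c ∧
    ∀ x : EuclideanSpace ℝ (Fin n), x ≠ 0 → ∀ R : ℝ, 0 ≤ R →
      grassmannMeasure h {V | ‖V.proj x‖ ≤ R} ≤ ENNReal.ofReal (c * (R / ‖x‖) ^ m) := by
  set v := volume.real (Metric.closedBall (0 : EuclideanSpace ℝ (Fin n)) 1) with hv
  have hv0 : 0 < v := ENNReal.toReal_pos
    (Metric.measure_closedBall_pos volume _ one_pos).ne' measure_closedBall_lt_top.ne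
  -- The ratio of the box volume to the ball volume gives `2 ^ n / v`; the maximum with `1` lets the
  -- same constant dominate the trivial bound on a probability.
  refine ⟨max 1 (2 ^ n / v), le_max_left _ _, fun x hx R hR => ?_⟩
  have hx0 : 0 < ‖x‖ := norm_pos_iff.2 hx
  have e : grassmannMeasure h {V | ‖V.proj x‖ ≤ R} =
      OrthGroup.haar n {g | ‖(Grassmann.base h).proj ((g⁻¹).act x)‖ ≤ R} := by
    rw [grassmannMeasure, Measure.map_apply (Grassmann.continuous_image _).measurable
      (measurableSet_norm_proj_le x R)]
    congr 1
    ext g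
    simp only [mem_preimage, mem_ofPred_eq, Grassmann.norm_proj_image]
  have hvol : volume (Metric.closedBall (0 : EuclideanSpace ℝ (Fin n)) ‖x‖) =
      ENNReal.ofReal (‖x‖ ^ n * v) := by
    rw [Measure.addHaar_closedBall' _ _ hx0.le, finrank_euclideanSpace_fin,
      ENNReal.ofReal_mul (by positivity), hv, ofReal_measureReal measure_closedBall_lt_top.ne]
  have key := (OrthGroup.haar_mul_volume_le h (x := x) (R := R)).trans
    (Grassmann.volume_norm_proj_base_le h hx0.le hR)
  rw [← e, hvol] at key
  have hpos : 0 < ‖x‖ ^ n * v := by positivity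
  rw [← ENNReal.le_div_iff_mul_le (Or.inl (ENNReal.ofReal_pos.2 hpos).ne')
    (Or.inl ENNReal.ofReal_ne_top), ← ENNReal.ofReal_div_of_pos hpos] at key
  refine key.trans (ENNReal.ofReal_le_ofReal ?_)
  have e2 : 2 ^ n * R ^ m * ‖x‖ ^ (n - m) / (‖x‖ ^ n * v) = 2 ^ n / v * (R / ‖x‖) ^ m := by
    have : ‖x‖ ^ n = ‖x‖ ^ (n - m) * ‖x‖ ^ m := by rw [← pow_add, Nat.sub_add_cancel h]
    rw [this, div_pow]
    field_simp
  rw [e2]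
  gcongr
  exact le_max_right _ _

end RandomSubspace

/-! ### Averages of energies of projected measures -/

/-- A discretized version of the kernel `(r / |z|) ^ s` restricted to `|z| ≤ 4 r ^ θ`. -/
noncomputable def scaleKernel (r θ s : ℝ) (N : ℕ) (z : ℝ) : ℝ≥0∞ :=
  ∑ k ∈ Finset.range N,
    if r * 2 ^ k ≤ 4 * r ^ θ ∧ z ≤ r * 2 ^ k then ENNReal.ofReal ((r / (r * 2 ^ k)) ^ s) else 0

section Averages

variable {n m : ℕ} {r θ s : ℝ}

theorem measurable_scaleKernel (N : ℕ) : Measurable (scaleKernel r θ s N) :=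
  Finset.measurable_sum _ fun _ _ => Measurable.ite
    ((MeasurableSet.const _).inter measurableSet_Iic) measurable_const measurable_const

theorem measurable_scaleKernel_proj (N : ℕ) :
    Measurable fun q : Grassmann n m × (EuclideanSpace ℝ (Fin n) × EuclideanSpace ℝ (Fin n)) =>
      scaleKernel r θ s N ‖q.1.proj (q.2.2 - q.2.1)‖ := by
  refine (measurable_scaleKernel N).comp (Continuous.measurable ?_)
  have hp : Continuous (Grassmann.proj (n := n) (m := m)) := continuous_induced_dom
  have hd : Continuous fun q : Grassmann n m ×
      (EuclideanSpace ℝ (Fin n) × EuclideanSpace ℝ (Fin n)) => q.2.2 - q.2.1 := by fun_prop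
  exact ((hp.comp continuous_fst).clm_apply hd).norm

/-- The least dyadic scale above `d` is at most `2 * d ≤ 4 * r ^ θ`, which explains the cut-off `4 *
r ^ θ` in `scaleKernel`; its term alone gives the bound. -/
theorem le_scaleKernel {d z : ℝ} {j : ℕ} (hr : 0 < r) (hs : 0 ≤ s) (hzd : z ≤ d) (hrd : r ≤ d)
    (hd : d ≤ 2 * r ^ θ) (hdj : d ≤ r * 2 ^ j) :
    ENNReal.ofReal ((r / (2 * d)) ^ s) ≤ scaleKernel r θ s (j + 2) z := by
  classical
  have hd0 : 0 < d := hr.trans_le hrd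
  have hex : ∃ k : ℕ, d ≤ r * 2 ^ k := ⟨j, hdj⟩
  have hk := Nat.find_spec hex
  have hkj : Nat.find hex ≤ j := Nat.find_min' hex hdj
  have hk2 : r * 2 ^ Nat.find hex ≤ 2 * d := by
    rcases Nat.eq_zero_or_eq_succ_pred (Nat.find hex) with h | h
    · rw [h]; linarith
    · have hlt : r * 2 ^ (Nat.find hex).pred < d :=
        not_le.1 (Nat.find_min hex (by rw [h]; exact Nat.lt_succ_self _))
      rw [h, Nat.succ_eq_add_one, pow_succ]
      linarith
  have hpos : 0 < r * 2 ^ Nat.find hex := by positivity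
  refine le_trans ?_ (Finset.single_le_sum
    (f := fun k : ℕ => if r * 2 ^ k ≤ 4 * r ^ θ ∧ z ≤ r * 2 ^ k then
      ENNReal.ofReal ((r / (r * 2 ^ k)) ^ s) else 0) (fun _ _ => zero_le)
    (Finset.mem_range.2 (show Nat.find hex < j + 2 by omega)))
  rw [if_pos ⟨by linarith, hzd.trans hk⟩]
  refine ENNReal.ofReal_le_ofReal (Real.rpow_le_rpow (by positivity) ?_ hs)
  gcongr

/-- The left side is the value of a term of `scaleKernel` times the probability bound for its event.
Of the `m` powers of `R / max t r`, `s` turn `r / R` into `r / max t r`, and in the other `m - s`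
the scale `R` is replaced by `4 * r ^ θ`. -/
theorem scale_mul_min_le_radialKernel {R t : ℝ} {m : ℝ} (hr : 0 < r) (hs : 0 ≤ s) (hsm : s ≤ m)
    (hR : r ≤ R) (hRθ : R ≤ 4 * r ^ θ) :
    (r / R) ^ s * min 1 (R / max t r) ^ m ≤ 4 ^ m * radialKernel r θ s m t := by
  set X := max t r with hX
  have hX0 : 0 < X := lt_max_of_lt_right hr
  have hR0 : 0 < R := hr.trans_le hR
  have hrθ : 0 < r ^ θ := Real.rpow_pos_of_pos hr θ
  set u := min 1 (R / X) with hu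
  have hu0 : 0 < u := lt_min one_pos (div_pos hR0 hX0)
  have hms : 0 ≤ m - s := sub_nonneg.2 hsm
  have e1 : u ^ m = u ^ s * u ^ (m - s) := by rw [← Real.rpow_add hu0]; congr 1; ring
  have h1 : (r / R) ^ s * u ^ s ≤ (r / X) ^ s := by
    rw [← Real.mul_rpow (by positivity) hu0.le]
    refine Real.rpow_le_rpow (by positivity) ?_ hs
    calc r / R * u ≤ r / R * (R / X) := by gcongr; exact min_le_right _ _
      _ = r / X := by field_simp
  have h2 : u ≤ 4 * min 1 (r ^ θ / X) := by
    rw [mul_min_of_nonneg _ _ (by norm_num : (0 : ℝ) ≤ 4)]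
    refine min_le_min (by norm_num) ?_
    rw [mul_div_assoc']
    gcongr
  have hb0 : 0 < min 1 (r ^ θ / X) := lt_min one_pos (div_pos hrθ hX0)
  have h3 : u ^ (m - s) ≤ 4 ^ m * min 1 (r ^ θ / X) ^ (m - s) := by
    refine (Real.rpow_le_rpow hu0.le h2 hms).trans ?_
    rw [Real.mul_rpow (by norm_num) hb0.le]
    have : (4 : ℝ) ^ (m - s) ≤ 4 ^ m :=
      Real.rpow_le_rpow_of_exponent_le (by norm_num) (by linarith)
    gcongr
  calc (r / R) ^ s * u ^ m = ((r / R) ^ s * u ^ s) * u ^ (m - s) := by rw [e1]; ring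
    _ ≤ (r / X) ^ s * (4 ^ m * min 1 (r ^ θ / X) ^ (m - s)) := by gcongr
    _ = _ := by rw [radialKernel]; ring

theorem lintegral_scaleKernel_le (h : m ≤ n) {c : ℝ} (hc : 1 ≤ c)
    (hγ : ∀ x : EuclideanSpace ℝ (Fin n), x ≠ 0 → ∀ R : ℝ, 0 ≤ R →
      grassmannMeasure h {V | ‖V.proj x‖ ≤ R} ≤ ENNReal.ofReal (c * (R / ‖x‖) ^ m))
    (hr : 0 < r) (hs : 0 ≤ s) (hsm : s ≤ m) (N : ℕ) (x : EuclideanSpace ℝ (Fin n)) :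
    ∫⁻ V, scaleKernel r θ s N ‖Grassmann.proj V x‖ ∂(grassmannMeasure h) ≤
      ENNReal.ofReal (N * (c * 4 ^ m)  * radialKernel r θ s m ‖x‖) := by
  have hK : 0 < radialKernel r θ s m ‖x‖ := radialKernel_pos hr
  have hms : ∀ (k : ℕ), MeasurableSet {V : Grassmann n m |
      r * 2 ^ k ≤ 4 * r ^ θ ∧ ‖V.proj x‖ ≤ r * 2 ^ k} := fun k =>
    (MeasurableSet.const _).inter (measurableSet_norm_proj_le x _)
  have hk : ∀ k ∈ Finset.range N, ∫⁻ V, (if r * 2 ^ k ≤ 4 * r ^ θ ∧ ‖Grassmann.proj V x‖ ≤ r * 2 ^ k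
      then ENNReal.ofReal ((r / (r * 2 ^ k)) ^ s) else 0) ∂(grassmannMeasure h) ≤
      ENNReal.ofReal ((c * 4 ^ m)  * radialKernel r θ s m ‖x‖) := by
    intro k _
    set R := r * 2 ^ k with hR
    have hrR : r ≤ R := le_mul_of_one_le_right hr.le (one_le_pow₀ one_le_two)
    have hR0 : 0 < R := hr.trans_le hrR
    by_cases hRθ : R ≤ 4 * r ^ θ
    · simp only [hRθ, true_and]
      have hγ' : grassmannMeasure h {V | ‖V.proj x‖ ≤ R} ≤
          ENNReal.ofReal (c * min 1 (R / max ‖x‖ r) ^ m) := by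
        -- For `x` no longer than `R` the trivial bound by `1` is used; this also covers `x = 0`.
        rcases le_or_gt (max ‖x‖ r) R with hX | hX
        · rw [min_eq_left ((one_le_div (lt_max_of_lt_right hr)).2 hX), one_pow, mul_one]
          exact prob_le_one.trans (ENNReal.one_le_ofReal.2 hc)
        · have hx : r < ‖x‖ := by
            by_contra! hcon
            rw [max_eq_right hcon] at hX
            linarith
          rw [min_eq_right ((div_le_one (lt_max_of_lt_right hr)).2 hX.le), max_eq_left hx.le]
          exact hγ x (norm_pos_iff.1 (hr.trans hx)) R hR0.le
      have hind : ∀ V : Grassmann n m, (if ‖V.proj x‖ ≤ R then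
          ENNReal.ofReal ((r / R) ^ s) else 0) =
          {V : Grassmann n m | ‖V.proj x‖ ≤ R}.indicator
            (fun _ => ENNReal.ofReal ((r / R) ^ s)) V := fun V => by
        simp [Set.indicator_apply]
      simp_rw [hind]
      rw [lintegral_indicator_const (measurableSet_norm_proj_le x R)]
      have hrRs : 0 ≤ (r / R) ^ s := by positivity
      calc _ ≤ ENNReal.ofReal ((r / R) ^ s) * ENNReal.ofReal (c * min 1 (R / max ‖x‖ r) ^ m) := by
            gcongr
        _ = ENNReal.ofReal (c * ((r / R) ^ s * min 1 (R / max ‖x‖ r) ^ m)) := by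
            rw [← ENNReal.ofReal_mul hrRs]; congr 1; ring
        _ ≤ _ := by
            refine ENNReal.ofReal_le_ofReal ?_
            have := scale_mul_min_le_radialKernel (t := ‖x‖) hr hs hsm hrR hRθ
            rw [Real.rpow_natCast, Real.rpow_natCast] at this
            rw [mul_assoc]
            gcongr
    · simp [hRθ]
  unfold scaleKernel
  rw [lintegral_finsetSum _ fun k _ => Measurable.ite (hms k) measurable_const measurable_const]
  refine (Finset.sum_le_sum hk).trans_eq ?_
  rw [Finset.sum_const, Finset.card_range, nsmul_eq_mul, ← ENNReal.ofReal_natCast,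
    ← ENNReal.ofReal_mul (by positivity)]
  congr 1
  ring

theorem lintegral_prod_kernel_eq (μ : Measure (EuclideanSpace ℝ (Fin n))) [IsProbabilityMeasure μ]
    {k : EuclideanSpace ℝ (Fin n) → ℝ} (hk : Measurable k) (h0 : ∀ x, 0 ≤ k x)
    (h1 : ∀ x, k x ≤ 1) :
    ∫⁻ p, ENNReal.ofReal (k (p.2 - p.1)) ∂(μ.prod μ) = ENNReal.ofReal (kernelEnergy k μ) := by
  rw [← ofReal_integral_eq_lintegral_ofReal (integrable_kernel_prod hk h0 h1)
    (Eventually.of_forall fun _ => h0 _), integral_prod _ (integrable_kernel_prod hk h0 h1)]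
  rfl

/-- The averaged energy of the projections of a measure is controlled by its energy. -/
theorem lintegral_energy_proj_le (h : m ≤ n) {c : ℝ} (hc : 1 ≤ c)
    (hγ : ∀ x : EuclideanSpace ℝ (Fin n), x ≠ 0 → ∀ R : ℝ, 0 ≤ R →
      grassmannMeasure h {V | ‖V.proj x‖ ≤ R} ≤ ENNReal.ofReal (c * (R / ‖x‖) ^ m))
    (hr : 0 < r) (hr1 : r ≤ 1) (hθ : θ ≤ 1) (hs : 0 ≤ s) (hsm : s ≤ m) (N : ℕ)
    (μ : Measure (EuclideanSpace ℝ (Fin n))) [IsProbabilityMeasure μ] :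
    ∫⁻ V, ∫⁻ p, scaleKernel r θ s N ‖Grassmann.proj V (p.2 - p.1)‖ ∂(μ.prod μ)
      ∂(grassmannMeasure h) ≤
      ENNReal.ofReal (N * (c * 4 ^ m) * kernelEnergy (interKernel r θ s m) μ) := by
  rw [lintegral_lintegral_swap (measurable_scaleKernel_proj N).aemeasurable]
  calc _ ≤ ∫⁻ p, ENNReal.ofReal (N * (c * 4 ^ m)) *
        ENNReal.ofReal (interKernel r θ s m (p.2 - p.1)) ∂(μ.prod μ) := by
        refine lintegral_mono fun p => ?_
        refine (lintegral_scaleKernel_le h hc hγ hr hs hsm N (p.2 - p.1)).trans_eq ?_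
        rw [ENNReal.ofReal_mul (by positivity), interKernel_eq hr hr1 hθ]
    _ = _ := by
        have hmeas := measurable_interKernel (n := n) hr hr1 hθ hs hsm
        rw [lintegral_const_mul _ (by
          exact (hmeas.comp (measurable_snd.sub measurable_fst)).ennreal_ofReal),
          lintegral_prod_kernel_eq μ hmeas (interKernel_nonneg hr hr1 hθ)
          (interKernel_le_one hr hr1 hθ hs hsm), ← ENNReal.ofReal_mul (by positivity)]

/-- At the dyadic scales, `closure F` carries measures whose projections to `V` have energies
that are nearly as small as the reciprocal of the capacity. -/
def HasRegularProjection (θ s : ℝ) (F : Set (EuclideanSpace ℝ (Fin n))) (V : Grassmann n m) :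
    Prop :=
  ∀ᶠ j : ℕ in atTop, ∃ μ : Measure (EuclideanSpace ℝ (Fin n)), IsProbabilityMeasure μ ∧
    μ (closure F)ᶜ = 0 ∧
    ∫⁻ p, scaleKernel ((1 / 2) ^ j) θ s (j + 2) ‖V.proj (p.2 - p.1)‖ ∂(μ.prod μ) ≤
      ENNReal.ofReal ((j + 2) ^ 3 * interMinEnergy ((1 / 2) ^ j) θ s m F)

/-- One near-minimizer is chosen for each `j`, independently of `V`. Its projected energy has mean
of order `j` times the minimal energy, so by Markov's inequality it exceeds the threshold with
factor `(j + 2) ^ 3` with probability of order `j ^ (-2)`, and Borel–Cantelli applies. -/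
theorem ae_hasRegularProjection [NeZero n] (h : m ≤ n) {F : Set (EuclideanSpace ℝ (Fin n))}
    (hF : F.Nonempty) (hb : Bornology.IsBounded F) (hθ0 : 0 ≤ θ) (hθ : θ ≤ 1) (hs : 0 ≤ s)
    (hsm : s ≤ m) : ∀ᵐ V ∂(grassmannMeasure h), HasRegularProjection θ s F V := by
  obtain ⟨c, hc, hγ⟩ := exists_grassmannMeasure_norm_proj_le h
  have hr : ∀ j : ℕ, (0 : ℝ) < (1 / 2) ^ j := fun j => by positivity
  have hr1 : ∀ j : ℕ, ((1 : ℝ) / 2) ^ j ≤ 1 := fun j => pow_le_one₀ (by norm_num) (by norm_num)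
  have hI : ∀ j : ℕ, 0 < interMinEnergy ((1 / 2) ^ j) θ s m F := fun j =>
    interMinEnergy_pos hF hb (hr j) (hr1 j) hθ0 hθ hs hsm
  choose μ hμ hμF hμE using fun j => exists_kernelEnergy_lt (k := interKernel ((1 / 2) ^ j) θ s m)
    hF.closure (a := 2 * interMinEnergy ((1 / 2) ^ j) θ s m F)
    (lt_mul_of_one_lt_left (hI j) one_lt_two)
  set f : ℕ → Grassmann n m → ℝ≥0∞ := fun j V =>
    ∫⁻ p, scaleKernel ((1 / 2) ^ j) θ s (j + 2) ‖V.proj (p.2 - p.1)‖ ∂((μ j).prod (μ j)) with hf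
  have hfm : ∀ j, Measurable (f j) := fun j =>
    Measurable.lintegral_prod_right' (measurable_scaleKernel_proj (j + 2))
  set a : ℕ → ℝ := fun j => (j + 2) ^ 3 * interMinEnergy ((1 / 2) ^ j) θ s m F with ha
  have ha0 : ∀ j, 0 < a j := fun j => by have := hI j; positivity
  have hbound : ∀ j, grassmannMeasure h {V | ENNReal.ofReal (a j) ≤ f j V} ≤
      ENNReal.ofReal (2 * (c * 4 ^ m) * (1 / ((j + 1 : ℕ) : ℝ) ^ 2)) := by
    intro j
    refine (meas_ge_le_lintegral_div (hfm j).aemeasurable (ENNReal.ofReal_pos.2 (ha0 j)).ne'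
      ENNReal.ofReal_ne_top).trans ?_
    refine (ENNReal.div_le_div_right (lintegral_energy_proj_le h hc hγ (hr j) (hr1 j) hθ hs hsm
      (j + 2) (μ j)) _).trans ?_
    rw [← ENNReal.ofReal_div_of_pos (ha0 j)]
    refine ENNReal.ofReal_le_ofReal ?_
    rw [div_le_iff₀ (ha0 j)]
    have hIj := hI j
    calc ((j + 2 : ℕ) : ℝ) * (c * 4 ^ m) * kernelEnergy (interKernel ((1 / 2) ^ j) θ s m) (μ j)
        ≤ ((j + 2 : ℕ) : ℝ) * (c * 4 ^ m) * (2 * interMinEnergy ((1 / 2) ^ j) θ s m F) := by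
          have := (hμE j).le
          gcongr
      _ = 2 * (c * 4 ^ m) * (1 / ((j : ℝ) + 2) ^ 2) * a j := by
          simp only [ha]
          push_cast
          field_simp
      _ ≤ _ := by
          have := ha0 j
          push_cast
          gcongr
          norm_num
  have hsum : ∑' j, grassmannMeasure h {V | ENNReal.ofReal (a j) ≤ f j V} ≠ ∞ := by
    refine ne_top_of_le_ne_top ?_ (ENNReal.tsum_le_tsum hbound)
    have : Summable fun j : ℕ => 2 * (c * 4 ^ m) * (1 / ((j + 1 : ℕ) : ℝ) ^ 2) :=
      ((summable_nat_add_iff 1).2 (Real.summable_one_div_nat_pow.2 one_lt_two)).mul_left _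
    exact this.tsum_ofReal_ne_top
  filter_upwards [ae_eventually_notMem hsum] with V hV
  exact hV.mono fun j hj => ⟨μ j, hμ j, hμF j, (not_le.1 hj).le⟩

end Averages

/-! ### Lower bounds for the intermediate dimensions of projections -/

section LowerBound

variable {n m : ℕ} {F : Set (EuclideanSpace ℝ (Fin n))}

/-- A measure whose projection has small energy forces covers of the projection to be costly. -/
theorem Grassmann.half_le_cost (V : Grassmann n m) (μ : Measure (EuclideanSpace ℝ (Fin n)))
    [IsProbabilityMeasure μ] (hμ : μ (closure F)ᶜ = 0) {r θ s ρ A : ℝ} {j : ℕ} (hr : 0 < r)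
    (hθ0 : 0 ≤ θ) (hθ : θ ≤ 1) (hs : 0 ≤ s) (hrρ : r ≤ ρ) (hρr : ρ ≤ 2 * r) (hρ1 : ρ ≤ 1)
    (hrj : 1 ≤ r * 2 ^ j) (hA : 0 < A)
    (hE : ∫⁻ p, scaleKernel r θ s (j + 2) ‖V.proj (p.2 - p.1)‖ ∂(μ.prod μ) ≤ ENNReal.ofReal A)
    {𝒰 : Set (Set (EuclideanSpace ℝ (Fin n)))} (h𝒰 : 𝒰.Finite) (hcov : V.proj '' F ⊆ ⋃₀ 𝒰)
    (hdiam : ∀ U ∈ 𝒰, ENNReal.ofReal ρ ≤ Metric.ediam U ∧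
      Metric.ediam U ≤ ENNReal.ofReal (ρ ^ θ)) :
    1 / 2 ≤ ENNReal.ofReal (2 * A * (2 / r) ^ s) *
      ∑' U : 𝒰, Metric.ediam (U : Set (EuclideanSpace ℝ (Fin n))) ^ s := by
  have hρ : 0 < ρ := hr.trans_le hrρ
  set P : EuclideanSpace ℝ (Fin n) → ℝ≥0∞ :=
    fun y => ∫⁻ x, scaleKernel r θ s (j + 2) ‖V.proj (x - y)‖ ∂μ with hP
  have hkm : Measurable fun p : EuclideanSpace ℝ (Fin n) × EuclideanSpace ℝ (Fin n) =>
      scaleKernel r θ s (j + 2) ‖V.proj (p.2 - p.1)‖ :=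
    (measurable_scaleKernel _).comp
      (V.proj.continuous.comp (continuous_snd.sub continuous_fst)).norm.measurable
  have hPm : Measurable P := hkm.lintegral_prod_right'
  have hPint : ∫⁻ y, P y ∂μ ≤ ENNReal.ofReal A := by
    rwa [lintegral_prod _ hkm.aemeasurable] at hE
  -- By Markov's inequality at least half of the mass lies where the projected potential is below `2
  -- * A`.
  set B := {y | ENNReal.ofReal (2 * A) ≤ P y} with hB
  have hBm : μ B ≤ 1 / 2 := by
    refine (meas_ge_le_lintegral_div hPm.aemeasurable (ENNReal.ofReal_pos.2 (by positivity)).ne'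
      ENNReal.ofReal_ne_top).trans ((ENNReal.div_le_div_right hPint _).trans_eq ?_)
    rw [← ENNReal.ofReal_div_of_pos (by positivity), show A / (2 * A) = 1 / 2 by field_simp,
      ENNReal.ofReal_div_of_pos two_pos]
    simp
  set T : Set (EuclideanSpace ℝ (Fin n)) → Set (EuclideanSpace ℝ (Fin n)) :=
    fun U => V.proj ⁻¹' closure U with hT
  -- The measure lives on `closure F`, while the cover is only one of the projection of `F`.
  -- Finiteness of `𝒰` makes the union of the closed pieces closed.
  have hclos : closure F ⊆ ⋃ U ∈ 𝒰, T U := by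
    have hcl : IsClosed (⋃ U ∈ 𝒰, T U) :=
      h𝒰.isClosed_biUnion fun U _ => isClosed_closure.preimage V.proj.continuous
    refine closure_minimal (fun x hx => ?_) hcl
    obtain ⟨U, hU, hxU⟩ := hcov (mem_image_of_mem _ hx)
    exact mem_biUnion hU (subset_closure hxU)
  -- Seen from a point `y` of the piece outside `B`, all of `T U` is within the diameter `d` after
  -- projection, so `(r / (2 * d)) ^ s * μ (T U) ≤ P y < 2 * A`.
  have hpiece : ∀ U ∈ 𝒰, μ (T U \ B) ≤
      ENNReal.ofReal (2 * A * (2 / r) ^ s) * Metric.ediam U ^ s := by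
    intro U hU
    rcases (T U \ B).eq_empty_or_nonempty with h | ⟨y, hyT, hyB⟩
    · simp [h]
    obtain ⟨hd1, hd2⟩ := hdiam U hU
    have hfin : Metric.ediam U ≠ ∞ := ne_top_of_le_ne_top ENNReal.ofReal_ne_top hd2
    set d := (Metric.ediam U).toReal with hd
    have hdU : Metric.ediam U = ENNReal.ofReal d := (ENNReal.ofReal_toReal hfin).symm
    have hρd : ρ ≤ d := (ENNReal.ofReal_le_iff_le_toReal hfin).1 hd1
    have hdρ : d ≤ ρ ^ θ := ENNReal.toReal_le_of_le_ofReal (Real.rpow_nonneg hρ.le _) hd2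
    have hd0 : 0 < d := hρ.trans_le hρd
    have hd2r : d ≤ 2 * r ^ θ := by
      refine hdρ.trans ((Real.rpow_le_rpow hρ.le hρr hθ0).trans ?_)
      rw [Real.mul_rpow two_pos.le hr.le]
      have : (2 : ℝ) ^ θ ≤ 2 := by
        simpa using Real.rpow_le_rpow_of_exponent_le one_le_two hθ
      gcongr
    have hd1' : d ≤ r * 2 ^ j := (hdρ.trans (Real.rpow_le_one hρ.le hρ1 hθ0)).trans hrj
    have hlow : ∀ x ∈ T U, ENNReal.ofReal ((r / (2 * d)) ^ s) ≤
        scaleKernel r θ s (j + 2) ‖V.proj (x - y)‖ := by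
      intro x hx
      refine le_scaleKernel hr hs ?_ (hrρ.trans hρd) hd2r hd1'
      rw [map_sub, ← dist_eq_norm, hd, ← Metric.ediam_closure U]
      exact Metric.dist_le_diam_of_mem' (by rwa [Metric.ediam_closure]) hx hyT
    have hTm : MeasurableSet (T U) :=
      (isClosed_closure.preimage V.proj.continuous).measurableSet
    have h1 : ENNReal.ofReal ((r / (2 * d)) ^ s) * μ (T U) ≤ ENNReal.ofReal (2 * A) :=
      calc _ = ∫⁻ _ in T U, ENNReal.ofReal ((r / (2 * d)) ^ s) ∂μ := by rw [setLIntegral_const]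
        _ ≤ ∫⁻ x in T U, scaleKernel r θ s (j + 2) ‖V.proj (x - y)‖ ∂μ :=
            setLIntegral_mono' hTm hlow
        _ ≤ P y := setLIntegral_le_lintegral _ _
        _ ≤ _ := (not_le.1 hyB).le
    have hpos : 0 < (r / (2 * d)) ^ s := by positivity
    have h2 : μ (T U) ≤ ENNReal.ofReal (2 * A) / ENNReal.ofReal ((r / (2 * d)) ^ s) := by
      rw [ENNReal.le_div_iff_mul_le (Or.inl (ENNReal.ofReal_pos.2 hpos).ne')
        (Or.inl ENNReal.ofReal_ne_top), mul_comm]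
      exact h1
    refine (measure_mono sdiff_subset).trans (h2.trans_eq ?_)
    rw [← ENNReal.ofReal_div_of_pos hpos, hdU, ENNReal.ofReal_rpow_of_pos hd0,
      ← ENNReal.ofReal_mul (by positivity)]
    congr 1
    rw [mul_assoc, ← Real.mul_rpow (by positivity) hd0.le, div_eq_mul_inv,
      ← Real.inv_rpow (by positivity)]
    congr 2
    field_simp
  have hone : (1 : ℝ≥0∞) ≤ 1 / 2 + ∑' U : 𝒰, μ (T U \ B) := by
    have hsub : (univ : Set (EuclideanSpace ℝ (Fin n))) ⊆
        (closure F)ᶜ ∪ (B ∪ ⋃ U ∈ 𝒰, T U \ B) := by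
      intro x _
      by_cases hx : x ∈ closure F
      · by_cases hxB : x ∈ B
        · exact Or.inr (Or.inl hxB)
        · obtain ⟨U, hU, hxU⟩ := mem_iUnion₂.1 (hclos hx)
          exact Or.inr (Or.inr (mem_biUnion hU ⟨hxU, hxB⟩))
      · exact Or.inl hx
    calc (1 : ℝ≥0∞) = μ univ := measure_univ.symm
      _ ≤ μ (closure F)ᶜ + (μ B + μ (⋃ U ∈ 𝒰, T U \ B)) :=
          (measure_mono hsub).trans ((measure_union_le _ _).trans
            (add_le_add_right (measure_union_le _ _) _))
      _ ≤ _ := by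
          rw [hμ, zero_add]
          exact add_le_add hBm (measure_biUnion_le μ h𝒰.countable _)
  have hhalf : (1 : ℝ≥0∞) / 2 ≤ ∑' U : 𝒰, μ (T U \ B) := by
    have h12 : (1 : ℝ≥0∞) / 2 ≠ ∞ := by simp
    refine (ENNReal.add_le_add_iff_left h12).1 ?_
    rwa [ENNReal.add_halves]
  refine hhalf.trans ?_
  rw [← ENNReal.tsum_mul_left]
  exact ENNReal.tsum_le_tsum fun U => hpiece U U.2

/-- Every set contributes at least `ρ ^ t` to a finite sum. -/
theorem ThetaCover.exists_finite {X : Type*} [PseudoMetricSpace X] {F : Set X} {θ ρ t ε : ℝ}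
    (hθ : 0 < θ) (hρ : 0 < ρ) (ht : 0 ≤ t) (h : ThetaCover F θ (ρ ^ θ) t ε) :
    ∃ 𝒰 : Set (Set X), 𝒰.Finite ∧ F ⊆ ⋃₀ 𝒰 ∧
      (∀ U ∈ 𝒰, ENNReal.ofReal ρ ≤ Metric.ediam U ∧ Metric.ediam U ≤ ENNReal.ofReal (ρ ^ θ)) ∧
      ∑' U : 𝒰, Metric.ediam (U : Set X) ^ t ≤ ENNReal.ofReal ε := by
  obtain ⟨𝒰, -, hcov, hd, hsum⟩ := h
  rw [← Real.rpow_mul hρ.le, mul_one_div_cancel hθ.ne', Real.rpow_one] at hd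
  refine ⟨𝒰, ?_, hcov, hd, hsum⟩
  have hne : ENNReal.ofReal ρ ^ t ≠ 0 := by
    rw [ENNReal.ofReal_rpow_of_pos hρ]
    exact (ENNReal.ofReal_pos.2 (Real.rpow_pos_of_pos hρ t)).ne'
  have := ENNReal.finite_const_le_of_tsum_ne_top
    (ne_top_of_le_ne_top ENNReal.ofReal_ne_top hsum) hne
  have huniv : {U : 𝒰 | ENNReal.ofReal ρ ^ t ≤ Metric.ediam (U : Set X) ^ t} = univ :=
    eq_univ_of_forall fun U => ENNReal.rpow_le_rpow (hd U U.2).1 ht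
  rw [huniv] at this
  exact Set.finite_coe_iff.1 (Set.finite_univ_iff.1 this)

/-- Because `θ' ≤ θ`, the diameters are also at most `ρ ^ θ'`; so the cover is admissible for `θ'`,
and its cost at exponent `s` is at most `ρ ^ (θ' * (s - t))` times that at `t`. -/
theorem ThetaCover.half_le_of_energy {θ θ' s t r ρ A : ℝ} {j : ℕ} {V : Grassmann n m}
    (h : ThetaCover (V.proj '' F) θ (ρ ^ θ) t 1) (hθ0 : 0 < θ') (hθθ : θ' ≤ θ) (hθ : θ ≤ 1)
    (ht : 0 ≤ t) (hts : t ≤ s) (hr : 0 < r) (hrρ : r ≤ ρ) (hρr : ρ ≤ 2 * r) (hρ1 : ρ ≤ 1)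
    (hrj : 1 ≤ r * 2 ^ j) (hA : 0 < A) (μ : Measure (EuclideanSpace ℝ (Fin n)))
    [IsProbabilityMeasure μ] (hμ : μ (closure F)ᶜ = 0)
    (hE : ∫⁻ p, scaleKernel r θ' s (j + 2) ‖V.proj (p.2 - p.1)‖ ∂(μ.prod μ) ≤
      ENNReal.ofReal A) :
    1 / 2 ≤ 2 * A * (4 / ρ) ^ s * ρ ^ (θ' * (s - t)) := by
  have hρ : 0 < ρ := hr.trans_le hrρ
  obtain ⟨𝒰, hfin, hcov, hd, hsum⟩ := h.exists_finite (hθ0.trans_le hθθ) hρ ht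
  have hd' : ∀ U ∈ 𝒰, ENNReal.ofReal ρ ≤ Metric.ediam U ∧
      Metric.ediam U ≤ ENNReal.ofReal (ρ ^ θ') := fun U hU => ⟨(hd U hU).1, (hd U hU).2.trans
        (ENNReal.ofReal_le_ofReal (Real.rpow_le_rpow_of_exponent_ge hρ hρ1 hθθ))⟩
  have hS : ∑' U : 𝒰, Metric.ediam (U : Set (EuclideanSpace ℝ (Fin n))) ^ s ≤
      ENNReal.ofReal (ρ ^ (θ' * (s - t))) := by
    calc _ ≤ ∑' U : 𝒰, ENNReal.ofReal (ρ ^ (θ' * (s - t))) *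
          Metric.ediam (U : Set (EuclideanSpace ℝ (Fin n))) ^ t := by
          refine ENNReal.tsum_le_tsum fun U => ?_
          have h1 := ENNReal.rpow_le_rpow (hd' U U.2).2 (sub_nonneg.2 hts)
          rw [ENNReal.ofReal_rpow_of_pos (Real.rpow_pos_of_pos hρ _), ← Real.rpow_mul hρ.le] at h1
          have h2 : Metric.ediam (U : Set (EuclideanSpace ℝ (Fin n))) ^ s =
              Metric.ediam (U : Set (EuclideanSpace ℝ (Fin n))) ^ (s - t) *
              Metric.ediam (U : Set (EuclideanSpace ℝ (Fin n))) ^ t := by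
            rw [← ENNReal.rpow_add_of_nonneg _ _ (sub_nonneg.2 hts) ht, sub_add_cancel]
          rw [h2]
          gcongr
      _ ≤ ENNReal.ofReal (ρ ^ (θ' * (s - t))) * ENNReal.ofReal 1 := by
          rw [ENNReal.tsum_mul_left]
          gcongr
      _ = _ := by simp
  have key := (V.half_le_cost μ hμ hr hθ0.le (hθθ.trans hθ) (ht.trans hts) hrρ hρr hρ1 hrj hA hE
    hfin hcov hd').trans (mul_le_mul_right hS _)
  rw [← ENNReal.ofReal_mul (by positivity)] at key
  have h12 : (1 : ℝ≥0∞) / 2 = ENNReal.ofReal (1 / 2) := by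
    rw [ENNReal.ofReal_div_of_pos two_pos]; simp
  rw [h12, ENNReal.ofReal_le_ofReal_iff (by positivity)] at key
  refine key.trans ?_
  have : 2 / r ≤ 4 / ρ := by
    rw [div_le_div_iff₀ hr hρ]; linarith
  have hs : 0 ≤ s := ht.trans hts
  gcongr

/-- For a subspace that is regular at suitable nearby parameters, large capacities exclude
efficient covers of the projection. -/
theorem HasRegularProjection.eventually_not_thetaCover {V : Grassmann n m} (hF : F.Nonempty)
    (hb : Bornology.IsBounded F) {θ θ' s s' t η : ℝ} (h : HasRegularProjection θ' s' F V)
    (hθ0 : 0 < θ') (hθθ : θ' ≤ θ) (hθ : θ ≤ 1) (ht : 0 ≤ t) (hts : t ≤ s') (hss : s' ≤ s)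
    (hsm : s ≤ m) (hη : η + (θ - θ') * m < θ' * (s' - t)) :
    ∀ᶠ ρ in 𝓝[>] 0, ρ ^ (-(s - η)) < interCapacity ρ θ s m F →
      ¬ ThetaCover (V.proj '' F) θ (ρ ^ θ) t 1 := by
  -- The power of `ρ` that remains after paying for the deficit of the capacity and for the change
  -- of `θ`.
  set κ := θ' * (s' - t) - η - (θ - θ') * m with hκ
  have hκ0 : 0 < κ := by linarith
  have hl2 : 0 < Real.log 2 := Real.log_pos one_lt_two
  have hs' : 0 ≤ s' := ht.trans hts
  have hlog : Tendsto (fun ρ : ℝ => -Real.log ρ / Real.log 2) (𝓝[>] 0) atTop :=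
    (tendsto_neg_atBot_atTop.comp Real.tendsto_log_nhdsGT_zero).atTop_div_const hl2
  have hj := (tendsto_nat_ceil_atTop.comp hlog).eventually h
  have hlim := ((tendsto_affine_log_mul_rpow 3 (-(1 / Real.log 2))
    (div_pos hκ0 three_pos)).pow 3).const_mul (2 * 4 ^ s')
  simp only [ne_eq, OfNat.ofNat_ne_zero, not_false_eq_true, zero_pow, mul_zero] at hlim
  filter_upwards [eventually_radius, hj,
    hlim.eventually (gt_mem_nhds (show (0 : ℝ) < 1 / 2 by norm_num))]
    with ρ ⟨hρ, hρ1⟩ hjρ hsmall hC hcov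
  set x := -Real.log ρ / Real.log 2 with hx
  have hx0 : 0 ≤ x := div_nonneg (neg_nonneg.2 (Real.log_nonpos hρ.le hρ1.le)) hl2.le
  have hjx : x ≤ (⌈x⌉₊ : ℝ) := Nat.le_ceil x
  have hjx' : (⌈x⌉₊ : ℝ) < x + 1 := Nat.ceil_lt_add_one hx0
  obtain ⟨μ, hμ, hμF, hE⟩ := hjρ
  simp only [Function.comp_apply] at hE
  rw [← hx] at hE
  -- The dyadic radius `(1 / 2) ^ j` then satisfies `r ≤ ρ ≤ 2 * r`.
  set j := ⌈x⌉₊ with hjdef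
  set r : ℝ := (1 / 2) ^ j with hr
  have hr0 : 0 < r := by positivity
  have hlogr : Real.log r = -(j * Real.log 2) := by
    rw [hr, one_div, Real.log_pow, Real.log_inv]; ring
  have hrρ : r ≤ ρ := by
    rw [← Real.log_le_log_iff hr0 hρ, hlogr]
    rw [hx, div_le_iff₀ hl2] at hjx
    linarith
  have hρr : ρ ≤ 2 * r := by
    rw [← Real.log_le_log_iff hρ (by positivity), Real.log_mul two_ne_zero hr0.ne', hlogr]
    rw [hx, ← sub_lt_iff_lt_add, lt_div_iff₀ hl2] at hjx'
    linarith
  have hrj : 1 ≤ r * 2 ^ j := by rw [hr, ← mul_pow]; norm_num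
  have hr1 : r ≤ 1 := hrρ.trans hρ1.le
  have hθ0' := hθ0.trans_le hθθ
  have hs'm : s' ≤ m := hss.trans hsm
  have hI : 0 < interMinEnergy r θ' s' m F :=
    interMinEnergy_pos hF hb hr0 hr1 hθ0.le (hθθ.trans hθ) hs' hs'm
  have hA : 0 < ((j : ℝ) + 2) ^ 3 * interMinEnergy r θ' s' m F := by positivity
  have key := hcov.half_le_of_energy hθ0 hθθ hθ ht hts hr0 hrρ hρr hρ1.le hrj hA μ hμF hE
  -- comparison of the capacities at the two sets of parameters
  have hcap : ρ ^ (-(s - η)) ≤ ρ ^ (-((1 - θ) * (s - s'))) *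
      (ρ ^ (-((θ - θ') * (m - s'))) * (interMinEnergy r θ' s' m F)⁻¹) := by
    refine hC.le.trans ((interCapacity_le_mul_exponent hF hb hρ hρ1.le hθ0'.le hθ hs' hss
      hsm).trans ?_)
    refine mul_le_mul_of_nonneg_left ?_ (Real.rpow_nonneg hρ.le _)
    refine (interCapacity_le_mul_theta hF hb hρ hρ1.le hθ0.le hθθ hθ hs' hs'm).trans ?_
    refine mul_le_mul_of_nonneg_left ?_ (Real.rpow_nonneg hρ.le _)
    exact interCapacity_anti_radius hF hb hr0 hrρ hρ1.le hθ0.le (hθθ.trans hθ) hs' hs'm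
  have hIle : interMinEnergy r θ' s' m F ≤
      ρ ^ (s - η - (1 - θ) * (s - s') - (θ - θ') * (m - s')) := by
    rw [← mul_assoc, ← Real.rpow_add hρ, ← div_eq_mul_inv, le_div_iff₀ hI, mul_comm,
      ← le_div_iff₀ (Real.rpow_pos_of_pos hρ _), ← Real.rpow_sub hρ] at hcap
    refine hcap.trans_eq ?_
    congr 1
    ring
  -- The terms in `s - s'` combine to `θ * (s - s') ≥ 0`: lowering `s` to `s'` costs nothing in the
  -- end.
  have hexp : κ ≤ (s - η - (1 - θ) * (s - s') - (θ - θ') * (m - s')) - s' + θ' * (s' - t) := by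
    have h1 : 0 ≤ θ * (s - s') := mul_nonneg hθ0'.le (sub_nonneg.2 hss)
    have h2 : 0 ≤ (θ - θ') * s' := mul_nonneg (sub_nonneg.2 hθθ) hs'
    rw [hκ]
    linarith
  have hfinal : 2 * (((j : ℝ) + 2) ^ 3 * interMinEnergy r θ' s' m F) * (4 / ρ) ^ s' *
      ρ ^ (θ' * (s' - t)) ≤ 2 * 4 ^ s' * ((3 + -(1 / Real.log 2) * Real.log ρ) *
        ρ ^ (κ / 3)) ^ 3 := by
    have hjle : (j : ℝ) + 2 ≤ 3 + -(1 / Real.log 2) * Real.log ρ := by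
      have : x = -(1 / Real.log 2) * Real.log ρ := by rw [hx]; ring
      linarith
    calc _ = 2 * 4 ^ s' * ((j : ℝ) + 2) ^ 3 * (interMinEnergy r θ' s' m F * ρ ^ (-s') *
          ρ ^ (θ' * (s' - t))) := by
          rw [Real.div_rpow (by norm_num) hρ.le, Real.rpow_neg hρ.le]
          field_simp
      _ ≤ 2 * 4 ^ s' * ((j : ℝ) + 2) ^ 3 *
          (ρ ^ (s - η - (1 - θ) * (s - s') - (θ - θ') * (m - s')) * ρ ^ (-s') *
          ρ ^ (θ' * (s' - t))) := by gcongr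
      _ ≤ 2 * 4 ^ s' * ((j : ℝ) + 2) ^ 3 * ρ ^ κ := by
          rw [← Real.rpow_add hρ, ← Real.rpow_add hρ]
          have := Real.rpow_le_rpow_of_exponent_ge hρ hρ1.le hexp
          exact mul_le_mul_of_nonneg_left this (by positivity)
      _ = 2 * 4 ^ s' * (((j : ℝ) + 2) * ρ ^ (κ / 3)) ^ 3 := by
          have : (ρ ^ (κ / 3)) ^ 3 = ρ ^ κ := by
            rw [← Real.rpow_natCast, ← Real.rpow_mul hρ.le]
            congr 1
            push_cast
            ring
          rw [mul_pow, this]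
          ring
      _ ≤ _ := by gcongr
  linarith

/-- Regularity at all rational parameters. -/
def IsRegularForProjection (F : Set (EuclideanSpace ℝ (Fin n))) (V : Grassmann n m) : Prop :=
  ∀ q : ℚ × ℚ, (0 : ℝ) < q.1 → (q.1 : ℝ) ≤ 1 → (0 : ℝ) ≤ q.2 → (q.2 : ℝ) ≤ m →
    HasRegularProjection (q.1 : ℝ) (q.2 : ℝ) F V

theorem ae_isRegularForProjection [NeZero n] (h : m ≤ n) (hF : F.Nonempty)
    (hb : Bornology.IsBounded F) :
    ∀ᵐ V ∂(grassmannMeasure h), IsRegularForProjection F V := by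
  refine ae_all_iff.2 fun q => ?_
  by_cases hq : (0 : ℝ) < q.1 ∧ (q.1 : ℝ) ≤ 1 ∧ (0 : ℝ) ≤ q.2 ∧ (q.2 : ℝ) ≤ m
  · filter_upwards [ae_hasRegularProjection h hF hb hq.1.le hq.2.1 hq.2.2.1 hq.2.2.2]
      with V hV _ _ _ _ using hV
  · exact Eventually.of_forall fun V h1 h2 h3 h4 => absurd ⟨h1, h2, h3, h4⟩ hq

theorem IsRegularForProjection.eventually_not_thetaCover {V : Grassmann n m}
    (h : IsRegularForProjection F V) (hF : F.Nonempty) (hb : Bornology.IsBounded F) (hm : 0 < m)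
    {θ s t : ℝ} (hθ0 : 0 < θ) (hθ : θ ≤ 1) (ht : 0 ≤ t) (hts : t < s) (hsm : s ≤ m) :
    ∀ᶠ ρ in 𝓝[>] 0, ρ ^ (-(s - θ * (s - t) / 16)) < interCapacity ρ θ s m F →
      ¬ ThetaCover (V.proj '' F) θ (ρ ^ θ) t 1 := by
  have hm' : (0 : ℝ) < m := Nat.cast_pos.2 hm
  -- With `θ' > θ / 2` and `s' > (s + t) / 2`, the available gain `θ' * (s' - t)` is at least `4 *
  -- e`, while the capacity deficit is `e` and the change of `θ` costs less than `e`.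
  set e := θ * (s - t) / 16 with he
  have he0 : 0 < e := by have := sub_pos.2 hts; positivity
  obtain ⟨θ', h1, h2⟩ := exists_rat_btwn (show max (θ / 2) (θ - e / m) < θ from
    max_lt (by linarith) (by have := div_pos he0 hm'; linarith))
  obtain ⟨s', h3, h4⟩ := exists_rat_btwn (show (s + t) / 2 < s by linarith)
  have h5 : θ / 2 < θ' := (le_max_left _ _).trans_lt h1
  have h6 : θ - e / m < θ' := (le_max_right _ _).trans_lt h1
  have hθ' : (0 : ℝ) < θ' := by linarith
  have hs' : t ≤ s' := by linarith
  refine (h (θ', s') hθ' (h2.le.trans hθ) (ht.trans hs')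
    (h4.le.trans hsm)).eventually_not_thetaCover hF hb hθ' h2.le hθ ht hs' h4.le hsm ?_
  have h7 : (θ - θ') * m < e := by
    rw [← lt_div_iff₀ hm']; linarith
  have h8 : 4 * e ≤ θ' * (s' - t) := by
    have : θ / 2 * ((s - t) / 2) ≤ θ' * (s' - t) := by
      have := sub_pos.2 hts
      gcongr
      linarith
    rw [he]; linarith
  linarith

/-- If `t < s` were admissible, cheap covers would exist at arbitrarily small scales, whereas the
lower limit makes the capacity large at all small scales; the two conflict at a common scale. -/
theorem IsRegularForProjection.le_lowerInterDim [NeZero n] {V : Grassmann n m}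
    (h : IsRegularForProjection F V) (hF : F.Nonempty) (hb : Bornology.IsBounded F) (hm : 0 < m)
    {θ s : ℝ} (hs : IsLowerProfile θ m F s) (hθ0 : 0 < θ) (hθ : θ ≤ 1) :
    s ≤ lowerInterDim θ (V.proj '' F) := by
  -- The upper bound supplies an element of the set, without which its real infimum would be the
  -- default value `0`.
  refine le_csInf ⟨s + 1, hs.mem_lowerInterDim_set hF hb V hθ0 hθ (lt_add_one s)⟩ ?_
  rintro t ⟨ht, hcov⟩
  by_contra! hts
  have h1 := (frequently_thetaCover_iff hθ0).2 (hcov 1 one_pos)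
  have h2 := hs.eventually_gt hF hb hθ0.le hθ (η := θ * (s - t) / 16)
    (by have := sub_pos.2 hts; positivity)
  obtain ⟨ρ, hρ, h3, h4⟩ := (h1.and_eventually (h2.and
    (h.eventually_not_thetaCover hF hb hm hθ0 hθ ht hts hs.1.2))).exists
  exact h4 h3 hρ

/-- Here the quantifiers are exchanged: covers exist at all small scales, and the capacity is large
at arbitrarily small ones. -/
theorem IsRegularForProjection.le_upperInterDim [NeZero n] {V : Grassmann n m}
    (h : IsRegularForProjection F V) (hF : F.Nonempty) (hb : Bornology.IsBounded F) (hm : 0 < m)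
    {θ s : ℝ} (hs : IsUpperProfile θ m F s) (hθ0 : 0 < θ) (hθ : θ ≤ 1) :
    s ≤ upperInterDim θ (V.proj '' F) := by
  refine le_csInf ⟨s + 1, hs.mem_upperInterDim_set hF hb V hθ0 hθ (lt_add_one s)⟩ ?_
  rintro t ⟨ht, hcov⟩
  by_contra! hts
  have h1 := (eventually_thetaCover_iff hθ0).2 (hcov 1 one_pos)
  have h2 := hs.frequently_gt hF hb hθ0.le hθ (η := θ * (s - t) / 16)
    (by have := sub_pos.2 hts; positivity)
  obtain ⟨ρ, h3, hρ, h4⟩ := (h2.and_eventually (h1.and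
    (h.eventually_not_thetaCover hF hb hm hθ0 hθ ht hts hs.1.2))).exists
  exact h4 h3 hρ

end LowerBound

theorem theorem7p1 (n m : ℕ) (hm : 1 ≤ m) (hmn : m ≤ n)
    (F : Set (EuclideanSpace ℝ (Fin n))) (hF : F.Nonempty) (hb : Bornology.IsBounded F) :
    (∀ θ ∈ Set.Ioc (0 : ℝ) 1,
      (∃! s : ℝ, IsLowerProfile θ m F s) ∧ (∃! s : ℝ, IsUpperProfile θ m F s)) ∧
    (∀ V : Grassmann n m, ∀ θ ∈ Set.Ioc (0 : ℝ) 1,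
      lowerInterDim θ (V.proj '' F) ≤ lowerProfile θ m F ∧
      upperInterDim θ (V.proj '' F) ≤ upperProfile θ m F) ∧
    (∀ᵐ V ∂(grassmannMeasure hmn), ∀ θ ∈ Set.Ioc (0 : ℝ) 1,
      lowerInterDim θ (V.proj '' F) = lowerProfile θ m F ∧
      upperInterDim θ (V.proj '' F) = upperProfile θ m F) := by
  have hn : NeZero n := ⟨by omega⟩
  have hm0 : (0 : ℝ) ≤ m := Nat.cast_nonneg m
  have hle : ∀ V : Grassmann n m, ∀ θ ∈ Set.Ioc (0 : ℝ) 1,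
      lowerInterDim θ (V.proj '' F) ≤ lowerProfile θ m F ∧
      upperInterDim θ (V.proj '' F) ≤ upperProfile θ m F := fun V θ hθ =>
    ⟨(isLowerProfile_lowerProfile hF hb hθ.1 hθ.2 hm0).lowerInterDim_proj_le hF hb V hθ.1 hθ.2,
      (isUpperProfile_upperProfile hF hb hθ.1 hθ.2 hm0).upperInterDim_proj_le hF hb V hθ.1 hθ.2⟩
  refine ⟨fun θ hθ => ⟨existsUnique_isLowerProfile hF hb hθ.1 hθ.2 hm0,
    existsUnique_isUpperProfile hF hb hθ.1 hθ.2 hm0⟩, hle, ?_⟩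
  filter_upwards [ae_isRegularForProjection hmn hF hb] with V hV θ hθ
  exact ⟨le_antisymm (hle V θ hθ).1 (hV.le_lowerInterDim hF hb hm
      (isLowerProfile_lowerProfile hF hb hθ.1 hθ.2 hm0) hθ.1 hθ.2),
    le_antisymm (hle V θ hθ).2 (hV.le_upperInterDim hF hb hm
      (isUpperProfile_upperProfile hF hb hθ.1 hθ.2 hm0) hθ.1 hθ.2)⟩
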